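/- Let $\mathbf{C}$ be any set of type constants, and let $\mathbf{COMET}$ be the following type theory over $\mathbf{C}$. **Types.** $A ::= c \mid 0 \mid 1 \mid A+B \mid A\otimes B$ with $c\in\mathbf{C}$. Put $0\cdot A=0$, $1\cdot A=A$, $(n+1)\cdot A=n\cdot A+A$ for $n\ge 1$; $\mathbf{n}=n\cdot 1$, so $\mathbf{2}=1+1$. **Terms** (up to $\alpha$-conversion). $t ::= x \mid * \mid s\otimes t \mid \mathsf{let}\,x\otimes y=s\,\mathsf{in}\,t \mid \mathsf{magic}(t) \mid \mathsf{inl}(t) \mid \mathsf{inr}(t) \mid \mathsf{case}\,r\,\mathsf{of}\,\mathsf{inl}(x)\mapsto s\mid\mathsf{inr}(y)\mapsto t \mid \langle\!\langle s,t\rangle\!\rangle \mid \mathsf{left}(t) \mid \mathsf{instr}_{\lambda x t}(s) \mid 1/n\ (n\ge2) \mid b_{mn}\ (1\le m<n) \mid \mathsf{norm}(t) \mid s\ovee t$. **Abbreviations.** $\top=\mathsf{inl}(*)$, $\bot=\mathsf{inr}(*)$, $\mathsf{return}\,t=\mathsf{inl}(t)$, $\mathsf{fail}=\mathsf{inr}(*)$;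 $(\mathsf{do}\,x\leftarrow s;t)=\mathsf{case}\,s\,\mathsf{of}\,\mathsf{inl}(x)\mapsto t\mid\mathsf{inr}(\_)\mapsto\mathsf{fail}$; $\mathsf{inl}?(t)=\mathsf{case}\,t\,\mathsf{of}\,\mathsf{inl}(\_)\mapsto\top\mid\mathsf{inr}(\_)\mapsto\bot$; $t{\downarrow}=\mathsf{inl}?(t)$ and $t{\uparrow}=\mathsf{case}\,t\,\mathsf{of}\,\mathsf{inl}(\_)\mapsto\bot\mid\mathsf{inr}(\_)\mapsto\top$. Let $\mathsf{in}^n_1,\dots,\mathsf{in}^n_n$ and $\mathsf{case}_{i=1}^n$ be the iterated injections and case distinction for $n$-fold sums (for $n=0$ the latter is $\mathsf{magic}$, for $n=1$ it is substitution); $\nabla(t)=\mathsf{case}_{i=1}^n\,t\,\mathsf{of}\,\mathsf{in}^n_i(x)\mapsto x$; $\mathsf{ind}(t)=\mathsf{case}_{i=1}^n\,t\,\mathsf{of}\,\mathsf{in}^n_i(\_)\mapsto\mathsf{in}^n_i(*)$; $\rhd_i(t)$ is the $\mathsf{case}_{j=1}^n$ that sends $\mathsf{in}^n_i(x)$ to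 $\mathsf{return}\,x$ and the other $\mathsf{in}^n_j(\_)$ to $\mathsf{fail}$; $\mathsf{assert}_{\lambda xp}(t)=\rhd_1(\mathsf{instr}_{\lambda xp}(t))$ (with $n=2$); $0\cdot t=\mathsf{fail}$, $1\cdot t=t$, $(n+1)\cdot t=n\cdot t\ovee t$ for $n\ge1$. **Judgements.** $\Gamma\vdash t:A$, $\Gamma\vdash s=t:A$ and $\Gamma\vdash s\le t:A$, where $\Gamma$ is a finite list of typed distinct variables. Contexts written $\Gamma,\Delta,\Theta$ side by side have disjoint variables. A judgement is *derivable* if it follows from the rules below. *Structural.* Exchange of adjacent variables in the context of any judgement; $\Gamma\vdash x:A$ if $(x:A)\in\Gamma$; $=$ is reflexive on well-typed terms, symmetric and transitive. *Unit.* $\Gamma\vdash *:1$; if $\Gamma\vdash t:1$ then $\Gamma\vdash t=*:1$. *Tensor.* If $\Gamma\vdash s:A$ and $\Delta\vdash t:B$ then $\Gamma,\Delta\vdash s\otimes t:A\otimes B$. If $\Gamma\vdash s:A\otimes B$ and $\Delta,x:A,y:B\vdash t:C$ then $\Gamma,\Delta\vdash\mathsf{let}\,x\otimes y=s\,\mathsf{in}\,t:C$.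 Both have the corresponding congruence rules for $=$. For well-typed terms (with disjoint contexts for $r$, $s$, $t$ in each of the following except the second): $\mathsf{let}\,x\otimes y=r\otimes s\,\mathsf{in}\,t=t[x:=r,y:=s]$; $\mathsf{let}\,x\otimes y=t\,\mathsf{in}\,x\otimes y=t$; $\mathsf{let}\,z\otimes w=(\mathsf{let}\,x\otimes y=r\,\mathsf{in}\,s)\,\mathsf{in}\,t=\mathsf{let}\,x\otimes y=r\,\mathsf{in}\,(\mathsf{let}\,z\otimes w=s\,\mathsf{in}\,t)$; $\mathsf{let}\,x\otimes y=r\,\mathsf{in}\,(s\otimes t)=(\mathsf{let}\,x\otimes y=r\,\mathsf{in}\,s)\otimes t$. *Empty type.* If $\Gamma\vdash t:0$ then $\Gamma\vdash\mathsf{magic}(t):A$. If $\Gamma\vdash s:0$ and $\Gamma\vdash t:A$ then $\Gamma\vdash\mathsf{magic}(s)=t:A$. *Coproducts.* If $\Gamma\vdash t:A$ then $\Gamma\vdash\mathsf{inl}(t):A+B$; if $\Gamma\vdash t:B$ then $\Gamma\vdash\mathsf{inr}(t):A+B$. If $\Gamma\vdash r:A+B$, $\Delta,x:A\vdash s:C$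 and $\Delta,y:B\vdash s':C$ then $\Gamma,\Delta\vdash\mathsf{case}\,r\,\mathsf{of}\,\mathsf{inl}(x)\mapsto s\mid\mathsf{inr}(y)\mapsto s':C$. All three have congruence rules. For well-typed terms, writing $[s\mid s']_r$ for that case term, with contexts $\Gamma$ for $r$, $\Delta$ for $s,s'$ and $\Theta$ for $t,t'$: $[s\mid s']_{\mathsf{inl}(r)}=s[x:=r]$; $[s\mid s']_{\mathsf{inr}(r)}=s'[y:=r]$; $[\mathsf{inl}(x)\mid\mathsf{inr}(y)]_r=r$; $[t\mid t']_{[s\mid s']_r}=[\,[t\mid t']_s\mid[t\mid t']_{s'}\,]_r$; $[s\otimes t\mid s'\otimes t]_r=[s\mid s']_r\otimes t$; $\mathsf{let}\,z\otimes w=[s\mid s']_r\,\mathsf{in}\,t=[\mathsf{let}\,z\otimes w=s\,\mathsf{in}\,t\mid\mathsf{let}\,z\otimes w=s'\,\mathsf{in}\,t]_r$. *Partial pairing.* If $\Gamma\vdash s:A+1$, $\Gamma\vdash t:B+1$ and $\Gamma\vdash s{\downarrow}=t{\uparrow}:\mathbf{2}$ then $\Gamma\vdash\langle\!\langle s,t\rangle\!\rangle:A+B$,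 $\Gamma\vdash\rhd_1(\langle\!\langle s,t\rangle\!\rangle)=s:A+1$ and $\Gamma\vdash\rhd_2(\langle\!\langle s,t\rangle\!\rangle)=t:B+1$; there is the congruence rule; and if $\Gamma\vdash t:A+B$ then $\Gamma\vdash\langle\!\langle\rhd_1(t),\rhd_2(t)\rangle\!\rangle=t:A+B$. *Left.* If $\Gamma\vdash t:A+B$ and $\Gamma\vdash\mathsf{inl}?(t)=\top:\mathbf{2}$ then $\Gamma\vdash\mathsf{left}(t):A$ and $\Gamma\vdash\mathsf{inl}(\mathsf{left}(t))=t:A+B$; there is the congruence rule; and if $\Gamma\vdash t:A$ then $\Gamma\vdash\mathsf{left}(\mathsf{inl}(t))=t:A$. *Joint monicity.* If $\Gamma\vdash s,t:(A+A)+1$ and $\Gamma\vdash(\mathsf{do}\,x\leftarrow s;\rhd_i(x))=(\mathsf{do}\,x\leftarrow t;\rhd_i(x)):A+1$ for $i=1,2$ then $\Gamma\vdash s=t:(A+A)+1$. *Instruments.* If $x:A\vdash t:\mathbf{n}$ and $\Gamma\vdash s:A$ then $\Gamma\vdash\mathsf{instr}_{\lambda xt}(s):n\cdot A$, $\Gamma\vdash\nabla(\mathsf{instr}_{\lambda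 xt}(s))=s:A$ and $\Gamma\vdash\mathsf{ind}(\mathsf{instr}_{\lambda xt}(s))=t[x:=s]:\mathbf{n}$; there is the congruence rule. If $x:A\vdash r:n\cdot A$, $x:A\vdash\nabla(r)=x:A$ and $\Gamma\vdash s:A$ then $\Gamma\vdash\mathsf{instr}_{\lambda x\,\mathsf{ind}(r)}(s)=r[x:=s]:n\cdot A$. If $x:A\vdash p:\mathbf{2}$, $x:A\vdash q:\mathbf{2}$ and $\Gamma\vdash t:A$ then $\Gamma\vdash(\mathsf{do}\,x\leftarrow\mathsf{assert}_{\lambda xp}(t);\mathsf{assert}_{\lambda xq}(x))=(\mathsf{do}\,x\leftarrow\mathsf{assert}_{\lambda xq}(t);\mathsf{assert}_{\lambda xp}(x)):A+1$. *Scalars.* For $n\ge2$: $\Gamma\vdash1/n:\mathbf{2}$; $\Gamma\vdash n\cdot(1/n)=\top:\mathbf{2}$; if $\Gamma\vdash n\cdot t=\top:\mathbf{2}$ then $\Gamma\vdash t=1/n:\mathbf{2}$. For $1\le m<n$: $\Gamma\vdash b_{mn}:\mathbf{3}$, $\Gamma\vdash\rhd_1(b_{mn})=m\cdot(1/n):\mathbf{2}$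 and $\Gamma\vdash\rhd_2(b_{mn})=1/n:\mathbf{2}$. *Normalisation.* Let $\vdash t:A+1$ and $\vdash1/n\le t{\downarrow}:\mathbf{2}$ for some $n\ge2$. Then $\Gamma\vdash\mathsf{norm}(t):A$ and $\Gamma\vdash(\mathsf{do}\,\_\leftarrow t;\mathsf{return}\,\mathsf{norm}(t))=t:A+1$; and if $\Gamma\vdash\rho:A$ and $\Gamma\vdash t=(\mathsf{do}\,\_\leftarrow t;\mathsf{return}\,\rho):A+1$ then $\Gamma\vdash\rho=\mathsf{norm}(t):A$. *Partial sum and order.* If $\Gamma\vdash b:(A+A)+1$, $\Gamma\vdash(\mathsf{do}\,x\leftarrow b;\rhd_1(x))=s:A+1$ and $\Gamma\vdash(\mathsf{do}\,x\leftarrow b;\rhd_2(x))=t:A+1$ then $\Gamma\vdash s\ovee t:A+1$ and $\Gamma\vdash s\ovee t=(\mathsf{do}\,x\leftarrow b;\mathsf{return}\,\nabla(x)):A+1$. If $\Gamma\vdash b:(A+A)+1$, $\Gamma\vdash(\mathsf{do}\,x\leftarrow b;\rhd_1(x))=s:A+1$ and $\Gamma\vdash(\mathsf{do}\,x\leftarrow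 b;\mathsf{return}\,\nabla(x))=t:A+1$ then $\Gamma\vdash s\le t:A+1$. **Corollary (Consistency).** $\mathbf{COMET}$ is non-degenerate: not every judgement is derivable. In particular, the judgement $\vdash\top=\bot:\mathbf{2}$ (in the empty context) is not derivable. -/

import Mathlib

namespace COMET

universe u

/-! ## Types and terms -/

/-- Types over a set `C` of type constants. -/
inductive Ty (C : Type u) : Type u
  | const (c : C) : Ty C
  | empty : Ty C
  | unit : Ty C
  | sum (A B : Ty C) : Ty C
  | tensor (A B : Ty C) : Ty C

/-- Terms up to `α`-conversion, in de Bruijn notation: `var i` refers to the `i`-th most recently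
declared variable. -/
inductive Term : Type
  | var (i : ℕ) : Term
  | star : Term
  /-- `s ⊗ t` -/
  | pair (s t : Term) : Term
  /-- `let x ⊗ y = s in t`, where in `t` the variable `x` has index `1` and `y` has index `0` -/
  | letPair (s t : Term) : Term
  | magic (t : Term) : Term
  | inl (t : Term) : Term
  | inr (t : Term) : Term
  /-- `case r of inl x ↦ s | inr y ↦ t`; each branch binds one variable -/
  | caseOf (r s t : Term) : Term
  /-- partial pairing `⟪s, t⟫` -/
  | inlr (s t : Term) : Term
  | left (t : Term) : Term
  /-- the instrument `instr_{λ x. t} (s)`, binding one variable in `t` -/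
  | instr (t s : Term) : Term
  /-- the scalar constant `1 / n` (only typable for `2 ≤ n`) -/
  | recip (n : ℕ) : Term
  /-- the constant `b_{m n}` (only typable for `1 ≤ m < n`) -/
  | bound (m n : ℕ) : Term
  | norm (t : Term) : Term
  /-- the partial sum `s ⊻ t` -/
  | ovee (s t : Term) : Term

/-! ## Renaming and substitution -/

/-- Extends a renaming under one binder. -/
def liftR (ρ : ℕ → ℕ) : ℕ → ℕ
  | 0 => 0
  | i + 1 => ρ i + 1

namespace Term

def rename (ρ : ℕ → ℕ) : Term → Term
  | var i => var (ρ i)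
  | star => star
  | pair s t => pair (s.rename ρ) (t.rename ρ)
  | letPair s t => letPair (s.rename ρ) (t.rename (liftR (liftR ρ)))
  | magic t => magic (t.rename ρ)
  | inl t => inl (t.rename ρ)
  | inr t => inr (t.rename ρ)
  | caseOf r s t => caseOf (r.rename ρ) (s.rename (liftR ρ)) (t.rename (liftR ρ))
  | inlr s t => inlr (s.rename ρ) (t.rename ρ)
  | left t => left (t.rename ρ)
  | instr t s => instr (t.rename (liftR ρ)) (s.rename ρ)
  | recip n => recip n
  | bound m n => bound m n
  | norm t => norm (t.rename ρ)
  | ovee s t => ovee (s.rename ρ) (t.rename ρ)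

/-- Weakening of a term by `k` new variables at the end of the context. -/
def shift (k : ℕ) (t : Term) : Term := t.rename (fun i => i + k)

/-- The same, below one bound variable, which stays in place. -/
def shiftUnder (k : ℕ) (t : Term) : Term := t.rename (liftR fun i => i + k)

/-- The same, below two bound variables, which stay in place. -/
def shiftUnderTwo (k : ℕ) (t : Term) : Term := t.rename (liftR (liftR fun i => i + k))

end Term

/-- Extends a substitution under one binder. -/
def liftS (σ : ℕ → Term) : ℕ → Term
  | 0 => .var 0
  | i + 1 => (σ i).shift 1

namespace Term

/-- Simultaneous capture-avoiding substitution. -/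
def subst (σ : ℕ → Term) : Term → Term
  | var i => σ i
  | star => star
  | pair s t => pair (s.subst σ) (t.subst σ)
  | letPair s t => letPair (s.subst σ) (t.subst (liftS (liftS σ)))
  | magic t => magic (t.subst σ)
  | inl t => inl (t.subst σ)
  | inr t => inr (t.subst σ)
  | caseOf r s t => caseOf (r.subst σ) (s.subst (liftS σ)) (t.subst (liftS σ))
  | inlr s t => inlr (s.subst σ) (t.subst σ)
  | left t => left (t.subst σ)
  | instr t s => instr (t.subst (liftS σ)) (s.subst σ)
  | recip n => recip n
  | bound m n => bound m n
  | norm t => norm (t.subst σ)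
  | ovee s t => ovee (s.subst σ) (t.subst σ)

/-- `t[x := r]`, where `x` is the last variable of the context of `t`. -/
def inst (t r : Term) : Term :=
  t.subst fun
    | 0 => r
    | i + 1 => var i

/-- `t[x := r, y := s]`, where `x`, `y` (in this order) are the last two variables of the context
of `t`. -/
def instTwo (t r s : Term) : Term :=
  t.subst fun
    | 0 => s
    | 1 => r
    | i + 2 => var i

end Term

/-! ## Defined constructions -/

namespace Ty

variable {C : Type u}

/-- The copower `n · A = A + ⋯ + A`, bracketed to the left, with `0 · A = 0` and `1 · A = A`. -/
def copower : ℕ → Ty C → Ty C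
  | 0, _ => empty
  | 1, A => A
  | n + 2, A => sum (copower (n + 1) A) A

/-- The finite type `𝐧 = n · 1`. -/
def fin (n : ℕ) : Ty C := copower n unit

/-- The type `𝟐 = 1 + 1` of propositions. -/
def two : Ty C := sum unit unit

/-- `A + 1`, the type of partial computations with values in `A`. -/
def partialTy (A : Ty C) : Ty C := sum A unit

end Ty

namespace Term

/-- `⊤ = inl *` -/
def top : Term := inl star

/-- `⊥ = inr *` -/
def bot : Term := inr star

/-- `return t = inl t` -/
def ret (t : Term) : Term := inl t

/-- `fail = inr *` -/
def fail : Term := inr star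

/-- `do x ← s; t`, binding one variable in `t`. -/
def doBind (s t : Term) : Term := caseOf s t fail

/-- The predicate `inl? t`; for `t : A + 1` it is the domain predicate `t ↓`. -/
def isInl (t : Term) : Term := caseOf t top bot

/-- The domain predicate `t ↓` of `t : A + 1`. -/
def dom (t : Term) : Term := isInl t

/-- The kernel predicate `t ↑` of `t : A + 1`. -/
def ker (t : Term) : Term := caseOf t bot top

/-- The `n`-ary coprojections, counted from `0`: for `i < n`, `inj n i t` is `in_{i+1}^n (t)`. -/
def inj : ℕ → ℕ → Term → Term
  | 0, _, t => t
  | 1, _, t => t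
  | n + 2, i, t => if i = n + 1 then inr t else inl (inj (n + 1) i t)

/-- The `n`-ary case distinction `case_{i=1}^n t of in_i^n (x) ↦ br_i`, with branches counted from
`0`, each binding one variable. -/
def caseN : ℕ → Term → (ℕ → Term) → Term
  | 0, t, _ => magic t
  | 1, t, br => (br 0).inst t
  | n + 2, t, br => caseOf t (caseN (n + 1) (var 0) fun i => (br i).shiftUnder 1) (br (n + 1))

/-- The codiagonal `∇ (t) : A` of `t : n · A`. -/
def nabla (n : ℕ) (t : Term) : Term := caseN n t fun _ => var 0

/-- The index `ind (t) : 𝐧` of `t : n · A`. -/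
def ind (n : ℕ) (t : Term) : Term := caseN n t fun i => inj n i star

/-- The partial projection `▷_{i+1}^n (t)`. With `n = 2` it makes sense for every
`t : A₁ + A₂`, and then has type `A_{i+1} + 1`. -/
def proj (n i : ℕ) (t : Term) : Term :=
  caseN n t fun j => if j = i then ret (var 0) else fail

/-- `assert_{λ x. p} (t)`, binding one variable in `p`. -/
def assertMap (p t : Term) : Term := caseOf (instr p t) (ret (var 0)) fail

/-- `n · t = t ⊻ ⋯ ⊻ t`, bracketed to the left, with `0 · t = fail` and `1 · t = t`. -/
def nfold : ℕ → Term → Term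
  | 0, _ => fail
  | 1, t => t
  | n + 2, t => ovee (nfold (n + 1) t) t

end Term

/-! ## Judgements and rules of deduction -/

/-- The right-hand side of a judgement. -/
inductive Stmt (C : Type u) : Type u
  /-- `t : A` -/
  | hasType (t : Term) (A : Ty C) : Stmt C
  /-- `s = t : A` -/
  | eq (s t : Term) (A : Ty C) : Stmt C
  /-- `s ≤ t : A` -/
  | le (s t : Term) (A : Ty C) : Stmt C

def Stmt.rename {C : Type u} (ρ : ℕ → ℕ) : Stmt C → Stmt C
  | .hasType t A => .hasType (t.rename ρ) A
  | .eq s t A => .eq (s.rename ρ) (t.rename ρ) A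
  | .le s t A => .le (s.rename ρ) (t.rename ρ) A

/-- A context lists the types of its variables, the most recently declared one first. So the
context `Γ, x : A` is `A :: Γ`, and the concatenation `Γ, Δ` is `Δ ++ Γ`; terms over `Δ` are
then terms over `Γ, Δ` as they stand, and terms over `Γ` have to be shifted by `Δ.length`. -/
abbrev Ctx (C : Type u) : Type u := List (Ty C)

open Term Ty Stmt

/-- `Derivable Γ J`: the judgement `Γ ⊢ J` is derivable in `COMET`. -/
inductive Derivable {C : Type u} : Ctx C → Stmt C → Prop
  -- structural rules
  | exch {Γ Δ : Ctx C} {A B : Ty C} {J : Stmt C} :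
      Derivable (Δ ++ B :: A :: Γ) J →
      Derivable (Δ ++ A :: B :: Γ) (J.rename (Equiv.swap Δ.length (Δ.length + 1)))
  | var {Γ : Ctx C} {i : ℕ} {A : Ty C} :
      Γ[i]? = some A → Derivable Γ (hasType (var i) A)
  | refl {Γ : Ctx C} {t : Term} {A : Ty C} :
      Derivable Γ (hasType t A) → Derivable Γ (eq t t A)
  | symm {Γ : Ctx C} {s t : Term} {A : Ty C} :
      Derivable Γ (eq s t A) → Derivable Γ (eq t s A)
  | trans {Γ : Ctx C} {r s t : Term} {A : Ty C} :
      Derivable Γ (eq r s A) → Derivable Γ (eq s t A) → Derivable Γ (eq r t A)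
  -- the singleton type
  | unit {Γ : Ctx C} : Derivable Γ (hasType star unit)
  | eta_one {Γ : Ctx C} {t : Term} :
      Derivable Γ (hasType t unit) → Derivable Γ (eq t star unit)
  -- the tensor product
  | pair {Γ Δ : Ctx C} {s t : Term} {A B : Ty C} :
      Derivable Γ (hasType s A) → Derivable Δ (hasType t B) →
      Derivable (Δ ++ Γ) (hasType (pair (s.shift Δ.length) t) (tensor A B))
  | letPair {Γ Δ : Ctx C} {s t : Term} {A B D : Ty C} :
      Derivable Γ (hasType s (tensor A B)) → Derivable (B :: A :: Δ) (hasType t D) →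
      Derivable (Δ ++ Γ) (hasType (letPair (s.shift Δ.length) t) D)
  | pair_eq {Γ Δ : Ctx C} {s s' t t' : Term} {A B : Ty C} :
      Derivable Γ (eq s s' A) → Derivable Δ (eq t t' B) →
      Derivable (Δ ++ Γ)
        (eq (pair (s.shift Δ.length) t) (pair (s'.shift Δ.length) t') (tensor A B))
  | letPair_eq {Γ Δ : Ctx C} {s s' t t' : Term} {A B D : Ty C} :
      Derivable Γ (eq s s' (tensor A B)) → Derivable (B :: A :: Δ) (eq t t' D) →
      Derivable (Δ ++ Γ)
        (eq (letPair (s.shift Δ.length) t) (letPair (s'.shift Δ.length) t') D)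
  | beta_tensor {Γ Δ Θ : Ctx C} {r s t : Term} {A B D : Ty C} :
      Derivable Γ (hasType r A) → Derivable Δ (hasType s B) →
      Derivable (B :: A :: Θ) (hasType t D) →
      Derivable (Θ ++ (Δ ++ Γ))
        (eq (letPair (pair ((r.shift Δ.length).shift Θ.length) (s.shift Θ.length)) t)
          (t.instTwo ((r.shift Δ.length).shift Θ.length) (s.shift Θ.length)) D)
  | eta_tensor {Γ : Ctx C} {t : Term} {A B : Ty C} :
      Derivable Γ (hasType t (tensor A B)) →
      Derivable Γ (eq (letPair t (pair (var 1) (var 0))) t (tensor A B))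
  | let_let {Γ Δ Θ : Ctx C} {r s t : Term} {A B D E F : Ty C} :
      Derivable Γ (hasType r (tensor A B)) →
      Derivable (B :: A :: Δ) (hasType s (tensor D E)) →
      Derivable (E :: D :: Θ) (hasType t F) →
      Derivable (Θ ++ (Δ ++ Γ))
        (eq (letPair
              (letPair ((r.shift Δ.length).shift Θ.length) (s.shiftUnderTwo Θ.length)) t)
          (letPair ((r.shift Δ.length).shift Θ.length)
            (letPair (s.shiftUnderTwo Θ.length) (t.shiftUnderTwo 2))) F)
  | let_pair {Γ Δ Θ : Ctx C} {r s t : Term} {A B D E : Ty C} :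
      Derivable Γ (hasType r (tensor A B)) →
      Derivable (B :: A :: Δ) (hasType s D) →
      Derivable Θ (hasType t E) →
      Derivable (Θ ++ (Δ ++ Γ))
        (eq (letPair ((r.shift Δ.length).shift Θ.length)
              (pair (s.shiftUnderTwo Θ.length) (t.shift 2)))
          (pair (letPair ((r.shift Δ.length).shift Θ.length) (s.shiftUnderTwo Θ.length)) t)
          (tensor D E))
  -- the empty type
  | magic {Γ : Ctx C} {t : Term} {A : Ty C} :
      Derivable Γ (hasType t empty) → Derivable Γ (hasType (magic t) A)
  | eta_zero {Γ : Ctx C} {s t : Term} {A : Ty C} :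
      Derivable Γ (hasType s empty) → Derivable Γ (hasType t A) →
      Derivable Γ (eq (magic s) t A)
  -- binary coproducts
  | inl {Γ : Ctx C} {t : Term} {A B : Ty C} :
      Derivable Γ (hasType t A) → Derivable Γ (hasType (inl t) (sum A B))
  | inr {Γ : Ctx C} {t : Term} {A B : Ty C} :
      Derivable Γ (hasType t B) → Derivable Γ (hasType (inr t) (sum A B))
  | inl_eq {Γ : Ctx C} {s t : Term} {A B : Ty C} :
      Derivable Γ (eq s t A) → Derivable Γ (eq (inl s) (inl t) (sum A B))
  | inr_eq {Γ : Ctx C} {s t : Term} {A B : Ty C} :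
      Derivable Γ (eq s t B) → Derivable Γ (eq (inr s) (inr t) (sum A B))
  | caseOf {Γ Δ : Ctx C} {r s t : Term} {A B D : Ty C} :
      Derivable Γ (hasType r (sum A B)) →
      Derivable (A :: Δ) (hasType s D) → Derivable (B :: Δ) (hasType t D) →
      Derivable (Δ ++ Γ) (hasType (caseOf (r.shift Δ.length) s t) D)
  | caseOf_eq {Γ Δ : Ctx C} {r r' s s' t t' : Term} {A B D : Ty C} :
      Derivable Γ (eq r r' (sum A B)) →
      Derivable (A :: Δ) (eq s s' D) → Derivable (B :: Δ) (eq t t' D) →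
      Derivable (Δ ++ Γ)
        (eq (caseOf (r.shift Δ.length) s t) (caseOf (r'.shift Δ.length) s' t') D)
  | beta_inl {Γ Δ : Ctx C} {r s t : Term} {A B D : Ty C} :
      Derivable Γ (hasType r A) →
      Derivable (A :: Δ) (hasType s D) → Derivable (B :: Δ) (hasType t D) →
      Derivable (Δ ++ Γ)
        (eq (caseOf (inl (r.shift Δ.length)) s t) (s.inst (r.shift Δ.length)) D)
  | beta_inr {Γ Δ : Ctx C} {r s t : Term} {A B D : Ty C} :
      Derivable Γ (hasType r B) →
      Derivable (A :: Δ) (hasType s D) → Derivable (B :: Δ) (hasType t D) →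
      Derivable (Δ ++ Γ)
        (eq (caseOf (inr (r.shift Δ.length)) s t) (t.inst (r.shift Δ.length)) D)
  | eta_sum {Γ : Ctx C} {t : Term} {A B : Ty C} :
      Derivable Γ (hasType t (sum A B)) →
      Derivable Γ (eq (caseOf t (inl (var 0)) (inr (var 0))) t (sum A B))
  | case_case {Γ Δ Θ : Ctx C} {r s s' t t' : Term} {A B D E F : Ty C} :
      Derivable Γ (hasType r (sum A B)) →
      Derivable (A :: Δ) (hasType s (sum D E)) →
      Derivable (B :: Δ) (hasType s' (sum D E)) →
      Derivable (D :: Θ) (hasType t F) → Derivable (E :: Θ) (hasType t' F) →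
      Derivable (Θ ++ (Δ ++ Γ))
        (eq (caseOf
              (caseOf ((r.shift Δ.length).shift Θ.length)
                (s.shiftUnder Θ.length) (s'.shiftUnder Θ.length))
              t t')
          (caseOf ((r.shift Δ.length).shift Θ.length)
            (caseOf (s.shiftUnder Θ.length) (t.shiftUnder 1) (t'.shiftUnder 1))
            (caseOf (s'.shiftUnder Θ.length) (t.shiftUnder 1) (t'.shiftUnder 1)))
          F)
  | case_pair {Γ Δ Θ : Ctx C} {r s s' t : Term} {A B D E : Ty C} :
      Derivable Γ (hasType r (sum A B)) →
      Derivable (A :: Δ) (hasType s D) → Derivable (B :: Δ) (hasType s' D) →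
      Derivable Θ (hasType t E) →
      Derivable (Θ ++ (Δ ++ Γ))
        (eq (caseOf ((r.shift Δ.length).shift Θ.length)
              (pair (s.shiftUnder Θ.length) (t.shift 1))
              (pair (s'.shiftUnder Θ.length) (t.shift 1)))
          (pair
            (caseOf ((r.shift Δ.length).shift Θ.length)
              (s.shiftUnder Θ.length) (s'.shiftUnder Θ.length))
            t)
          (tensor D E))
  | let_case {Γ Δ Θ : Ctx C} {r s s' t : Term} {A B D E F : Ty C} :
      Derivable Γ (hasType r (sum A B)) →
      Derivable (A :: Δ) (hasType s (tensor D E)) →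
      Derivable (B :: Δ) (hasType s' (tensor D E)) →
      Derivable (E :: D :: Θ) (hasType t F) →
      Derivable (Θ ++ (Δ ++ Γ))
        (eq (letPair
              (caseOf ((r.shift Δ.length).shift Θ.length)
                (s.shiftUnder Θ.length) (s'.shiftUnder Θ.length))
              t)
          (caseOf ((r.shift Δ.length).shift Θ.length)
            (letPair (s.shiftUnder Θ.length) (t.shiftUnderTwo 1))
            (letPair (s'.shiftUnder Θ.length) (t.shiftUnderTwo 1)))
          F)
  -- partial pairing
  | inlr {Γ : Ctx C} {s t : Term} {A B : Ty C} :
      Derivable Γ (hasType s (partialTy A)) → Derivable Γ (hasType t (partialTy B)) →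
      Derivable Γ (eq (dom s) (ker t) two) →
      Derivable Γ (hasType (inlr s t) (sum A B))
  | inlr_eq {Γ : Ctx C} {s s' t t' : Term} {A B : Ty C} :
      Derivable Γ (eq s s' (partialTy A)) → Derivable Γ (eq t t' (partialTy B)) →
      Derivable Γ (eq (dom s) (ker t) two) →
      Derivable Γ (eq (inlr s t) (inlr s' t') (sum A B))
  | beta_inlr_one {Γ : Ctx C} {s t : Term} {A B : Ty C} :
      Derivable Γ (hasType s (partialTy A)) → Derivable Γ (hasType t (partialTy B)) →
      Derivable Γ (eq (dom s) (ker t) two) →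
      Derivable Γ (eq (proj 2 0 (inlr s t)) s (partialTy A))
  | beta_inlr_two {Γ : Ctx C} {s t : Term} {A B : Ty C} :
      Derivable Γ (hasType s (partialTy A)) → Derivable Γ (hasType t (partialTy B)) →
      Derivable Γ (eq (dom s) (ker t) two) →
      Derivable Γ (eq (proj 2 1 (inlr s t)) t (partialTy B))
  | eta_inlr {Γ : Ctx C} {t : Term} {A B : Ty C} :
      Derivable Γ (hasType t (sum A B)) →
      Derivable Γ (eq (inlr (proj 2 0 t) (proj 2 1 t)) t (sum A B))
  -- the left construction
  | left {Γ : Ctx C} {t : Term} {A B : Ty C} :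
      Derivable Γ (hasType t (sum A B)) → Derivable Γ (eq (isInl t) top two) →
      Derivable Γ (hasType (left t) A)
  | left_eq {Γ : Ctx C} {t t' : Term} {A B : Ty C} :
      Derivable Γ (eq t t' (sum A B)) → Derivable Γ (eq (isInl t) top two) →
      Derivable Γ (eq (left t) (left t') A)
  | beta_left {Γ : Ctx C} {t : Term} {A B : Ty C} :
      Derivable Γ (hasType t (sum A B)) → Derivable Γ (eq (isInl t) top two) →
      Derivable Γ (eq (inl (left t)) t (sum A B))
  | eta_left {Γ : Ctx C} {t : Term} {A : Ty C} :
      Derivable Γ (hasType t A) → Derivable Γ (eq (left (inl t)) t A)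
  -- joint monicity
  | joint_monic {Γ : Ctx C} {s t : Term} {A : Ty C} :
      Derivable Γ (hasType s (partialTy (sum A A))) →
      Derivable Γ (hasType t (partialTy (sum A A))) →
      Derivable Γ
        (eq (doBind s (proj 2 0 (var 0))) (doBind t (proj 2 0 (var 0))) (partialTy A)) →
      Derivable Γ
        (eq (doBind s (proj 2 1 (var 0))) (doBind t (proj 2 1 (var 0))) (partialTy A)) →
      Derivable Γ (eq s t (partialTy (sum A A)))
  -- instruments
  | instr {Γ : Ctx C} {n : ℕ} {s t : Term} {A : Ty C} :
      Derivable [A] (hasType t (fin n)) → Derivable Γ (hasType s A) →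
      Derivable Γ (hasType (instr t s) (copower n A))
  | nabla_instr {Γ : Ctx C} {n : ℕ} {s t : Term} {A : Ty C} :
      Derivable [A] (hasType t (fin n)) → Derivable Γ (hasType s A) →
      Derivable Γ (eq (nabla n (instr t s)) s A)
  | instr_test {Γ : Ctx C} {n : ℕ} {s t : Term} {A : Ty C} :
      Derivable [A] (hasType t (fin n)) → Derivable Γ (hasType s A) →
      Derivable Γ (eq (ind n (instr t s)) (t.inst s) (fin n))
  | eta_instr {Γ : Ctx C} {n : ℕ} {r s : Term} {A : Ty C} :
      Derivable [A] (hasType r (copower n A)) → Derivable [A] (eq (nabla n r) (var 0) A) →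
      Derivable Γ (hasType s A) →
      Derivable Γ (eq (instr (ind n r) s) (r.inst s) (copower n A))
  | instr_eq {Γ : Ctx C} {n : ℕ} {s s' t t' : Term} {A : Ty C} :
      Derivable [A] (eq t t' (fin n)) → Derivable Γ (eq s s' A) →
      Derivable Γ (eq (instr t s) (instr t' s') (copower n A))
  | comm {Γ : Ctx C} {p q t : Term} {A : Ty C} :
      Derivable [A] (hasType p two) → Derivable [A] (hasType q two) →
      Derivable Γ (hasType t A) →
      Derivable Γ
        (eq (doBind (assertMap p t) (assertMap q (var 0)))
          (doBind (assertMap q t) (assertMap p (var 0))) (partialTy A))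
  -- scalar constants
  | recip {Γ : Ctx C} {n : ℕ} : 2 ≤ n → Derivable Γ (hasType (recip n) two)
  | nfold_recip {Γ : Ctx C} {n : ℕ} :
      2 ≤ n → Derivable Γ (eq (nfold n (recip n)) top two)
  | divide {Γ : Ctx C} {n : ℕ} {t : Term} :
      2 ≤ n → Derivable Γ (eq (nfold n t) top two) → Derivable Γ (eq t (recip n) two)
  | bound {Γ : Ctx C} {m n : ℕ} :
      1 ≤ m → m < n → Derivable Γ (hasType (bound m n) (fin 3))
  | proj_one_bound {Γ : Ctx C} {m n : ℕ} :
      1 ≤ m → m < n →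
      Derivable Γ (eq (proj 3 0 (bound m n)) (nfold m (recip n)) two)
  | proj_two_bound {Γ : Ctx C} {m n : ℕ} :
      1 ≤ m → m < n → Derivable Γ (eq (proj 3 1 (bound m n)) (recip n) two)
  -- normalisation of closed substates
  | norm {Γ : Ctx C} {n : ℕ} {t : Term} {A : Ty C} :
      Derivable [] (hasType t (partialTy A)) →
      2 ≤ n → Derivable [] (le (recip n) (dom t) two) →
      Derivable Γ (hasType (norm t) A)
  | beta_norm {Γ : Ctx C} {n : ℕ} {t : Term} {A : Ty C} :
      Derivable [] (hasType t (partialTy A)) →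
      2 ≤ n → Derivable [] (le (recip n) (dom t) two) →
      Derivable Γ (eq (doBind t (ret ((norm t).shift 1))) t (partialTy A))
  | eta_norm {Γ : Ctx C} {n : ℕ} {t ρ : Term} {A : Ty C} :
      Derivable [] (hasType t (partialTy A)) →
      2 ≤ n → Derivable [] (le (recip n) (dom t) two) →
      Derivable Γ (hasType ρ A) →
      Derivable Γ (eq t (doBind t (ret (ρ.shift 1))) (partialTy A)) →
      Derivable Γ (eq ρ (norm t) A)
  -- partial sums and the ordering on partial maps
  | ovee {Γ : Ctx C} {b s t : Term} {A : Ty C} :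
      Derivable Γ (hasType b (partialTy (sum A A))) →
      Derivable Γ (eq (doBind b (proj 2 0 (var 0))) s (partialTy A)) →
      Derivable Γ (eq (doBind b (proj 2 1 (var 0))) t (partialTy A)) →
      Derivable Γ (hasType (ovee s t) (partialTy A))
  | ovee_def {Γ : Ctx C} {b s t : Term} {A : Ty C} :
      Derivable Γ (hasType b (partialTy (sum A A))) →
      Derivable Γ (eq (doBind b (proj 2 0 (var 0))) s (partialTy A)) →
      Derivable Γ (eq (doBind b (proj 2 1 (var 0))) t (partialTy A)) →
      Derivable Γ (eq (ovee s t) (doBind b (ret (nabla 2 (var 0)))) (partialTy A))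
  | le_intro {Γ : Ctx C} {b s t : Term} {A : Ty C} :
      Derivable Γ (hasType b (partialTy (sum A A))) →
      Derivable Γ (eq (doBind b (proj 2 0 (var 0))) s (partialTy A)) →
      Derivable Γ (eq (doBind b (ret (nabla 2 (var 0)))) t (partialTy A)) →
      Derivable Γ (le s t (partialTy A))

end COMET

/-!
`COMET` is sound for a probabilistic model, in which `⊤` and `⊥` of type `𝟐` are different point
masses.

A type denotes a set of values, a type constant a one-point set, and `Γ ⊢ t : A` denotes a Markov
kernel with finite supports: to an assignment of values to the variables of `Γ` it assigns a
finitely supported probability distribution on `A`. So the model is the Kleisli category of the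
finite distribution monad. An instrument `instr_{λ x. t} (s)` draws a value from `s`, runs the test
`t` on it, and returns the value unchanged, labelled with the outcome; `norm` conditions on
definedness; partial sums are sums of subdistributions. The rules that need nonnegativity of
probabilities are those for `left`, for normalisation, and the uniqueness of instruments
(`Equal.eta_instr`): a measure with deterministic image lives on a single fibre.

As typing and equality are defined by mutual recursion, terms are interpreted before they are known
to be typable: `Term.sem` assigns to every raw term a finitely supported signed measure on untyped
values, and typability only enters the notion of validity of a judgement (`Typed`, `Equal`,
`Valid`).

The delicate point is the substitution lemma `sem_subst`: substituting `r` for `x` in `t` amounts to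
first sampling `x` from `r` and then running `t`. This holds because terms are affine, that is,
subterms that are run one after the other share no variables. The two terms in a partial pairing or
in a partial sum may share variables, but both constructions are linear in the pair of measures, so
they commute with sampling; normalisation is not linear, but only applies to closed terms. For the
induction, an arbitrary simultaneous substitution is modelled by a random environment with
independent coordinates (`Indep`). Since affinity (`Term.Affine`) is a property of raw terms, it is
made part of the meaning of a typing judgement.

With this, each rule is checked in the model, and `Derivable.valid` follows by induction on
derivations.
-/

namespace COMET

universe u

/-! ### Finitely supported signed measures -/

section Measures

variable {X Y E F : Type*} [AddCommGroup E] [Module ℝ E] [AddCommGroup F] [Module ℝ F]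

/-- The point mass at `x`. -/
noncomputable def dirac (x : X) : X →₀ ℝ := Finsupp.single x 1

/-- The integral of `f` against the finitely supported signed measure `μ`. For `f` with values
in measures this is Kleisli composition. -/
noncomputable def bind (μ : X →₀ ℝ) (f : X → E) : E := Finsupp.linearCombination ℝ f μ

/-- The total mass. -/
noncomputable def mass (μ : X →₀ ℝ) : ℝ := bind μ fun _ => (1 : ℝ)

lemma bind_eq_sum (μ : X →₀ ℝ) (f : X → E) : bind μ f = ∑ x ∈ μ.support, μ x • f x := by
  rw [bind, Finsupp.linearCombination_apply, Finsupp.sum]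

@[simp] lemma bind_zero_left (f : X → E) : bind 0 f = 0 := map_zero _

@[simp] lemma bind_add_left (μ ν : X →₀ ℝ) (f : X → E) : bind (μ + ν) f = bind μ f + bind ν f :=
  map_add _ _ _

@[simp] lemma bind_sub_left (μ ν : X →₀ ℝ) (f : X → E) : bind (μ - ν) f = bind μ f - bind ν f :=
  map_sub _ _ _

@[simp] lemma bind_smul_left (a : ℝ) (μ : X →₀ ℝ) (f : X → E) : bind (a • μ) f = a • bind μ f :=
  map_smul _ _ _

@[simp] lemma bind_dirac_left (x : X) (f : X → E) : bind (dirac x) f = f x := by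
  simp [bind, dirac]

@[simp] lemma bind_zero_right (μ : X →₀ ℝ) : bind μ (fun _ => (0 : E)) = 0 := by
  simp [bind_eq_sum]

lemma bind_add_right (μ : X →₀ ℝ) (f g : X → E) :
    bind μ (fun x => f x + g x) = bind μ f + bind μ g := by
  simp [bind_eq_sum, Finset.sum_add_distrib]

lemma bind_const (μ : X →₀ ℝ) (e : E) : bind μ (fun _ => e) = mass μ • e := by
  simp [mass, bind_eq_sum, Finset.sum_smul]

lemma map_bind (L : E →ₗ[ℝ] F) (μ : X →₀ ℝ) (f : X → E) :
    L (bind μ f) = bind μ fun x => L (f x) := by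
  simp [bind_eq_sum, map_sum]

lemma smul_bind (a : ℝ) (μ : X →₀ ℝ) (f : X → E) : a • bind μ f = bind μ fun x => a • f x :=
  map_bind (LinearMap.lsmul ℝ E a) μ f

lemma bind_apply (μ : X →₀ ℝ) (f : X → Y →₀ ℝ) (y : Y) : bind μ f y = bind μ fun x => f x y :=
  map_bind (Finsupp.lapply y) μ f

lemma bind_bind (μ : X →₀ ℝ) (f : X → Y →₀ ℝ) (g : Y → E) :
    bind (bind μ f) g = bind μ fun x => bind (f x) g :=
  map_bind (Finsupp.linearCombination ℝ g) μ f

lemma bind_comm (μ : X →₀ ℝ) (ν : Y →₀ ℝ) (f : X → Y → E) :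
    (bind μ fun x => bind ν fun y => f x y) = bind ν fun y => bind μ fun x => f x y := by
  simp only [bind_eq_sum, Finset.smul_sum]
  rw [Finset.sum_comm]
  simp only [smul_comm (M := ℝ) (N := ℝ)]

@[simp] lemma bind_dirac_right (μ : X →₀ ℝ) : bind μ dirac = μ := by
  simp only [bind_eq_sum, dirac, Finsupp.smul_single, smul_eq_mul, mul_one]
  exact μ.sum_single

lemma bind_congr {μ : X →₀ ℝ} {f g : X → E} (h : ∀ x, μ x ≠ 0 → f x = g x) :
    bind μ f = bind μ g := by
  simp only [bind_eq_sum]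
  exact Finset.sum_congr rfl fun x hx => by rw [h x (by simpa using hx)]

/-- Being linear in `μ`, an integral equals the mass `μ y` of the point `y` as soon as it does so
for point masses `μ`. -/
lemma bind_eq_apply {μ : X →₀ ℝ} {f : X → ℝ} {y : X} (h : ∀ x, f x = dirac x y) :
    bind μ f = μ y := by
  rw [show f = fun x => dirac x y from funext h, ← bind_apply, bind_dirac_right]

@[simp] lemma mass_dirac (x : X) : mass (dirac x) = 1 := by simp [mass]

@[simp] lemma mass_add (μ ν : X →₀ ℝ) : mass (μ + ν) = mass μ + mass ν := by simp [mass]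

@[simp] lemma mass_sub (μ ν : X →₀ ℝ) : mass (μ - ν) = mass μ - mass ν := by simp [mass]

@[simp] lemma mass_smul (a : ℝ) (μ : X →₀ ℝ) : mass (a • μ) = a * mass μ := by simp [mass]

lemma mass_bind (μ : X →₀ ℝ) (f : X → Y →₀ ℝ) : mass (bind μ f) = bind μ fun x => mass (f x) :=
  bind_bind μ f _

lemma dirac_apply_self (x : X) : dirac x x = 1 := by simp [dirac]

lemma dirac_apply_of_ne {x y : X} (h : x ≠ y) : dirac x y = 0 := by simp [dirac, h]

lemma bind_nonneg {μ : X →₀ ℝ} {f : X → ℝ} (hμ : ∀ x, 0 ≤ μ x) (hf : ∀ x, μ x ≠ 0 → 0 ≤ f x) :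
    0 ≤ bind μ f := by
  rw [bind_eq_sum]
  exact Finset.sum_nonneg fun x hx => mul_nonneg (hμ x) (hf x (by simpa using hx))

lemma bind_eq_zero_iff {μ : X →₀ ℝ} {f : X → ℝ} (hμ : ∀ x, 0 ≤ μ x) (hf : ∀ x, 0 ≤ f x) :
    bind μ f = 0 ↔ ∀ x, μ x ≠ 0 → f x = 0 := by
  simp only [bind_eq_sum, smul_eq_mul]
  rw [Finset.sum_eq_zero_iff_of_nonneg fun x _ => mul_nonneg (hμ x) (hf x)]
  simp only [Finsupp.mem_support_iff, mul_eq_zero]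
  exact forall₂_congr fun x hx => by simp [hx]

end Measures

/-! ### Values, environments and the interpretation of terms -/

/-- The values of all types together: closed normal forms. -/
inductive Val : Type
  | star : Val
  | pair (a b : Val) : Val
  | inl (a : Val) : Val
  | inr (a : Val) : Val

/-- Eliminates pairs; other values are sent to `0`. -/
def onPair {E : Type*} [Zero E] (f : Val → Val → E) : Val → E
  | .pair a b => f a b
  | _ => 0

/-- Eliminates injections; other values are sent to `0`. -/
def onSum {E : Type*} [Zero E] (f g : Val → E) : Val → E
  | .inl a => f a
  | .inr b => g b
  | _ => 0

/-- `tag w v` puts `v` in place of the `*` in a value `w = in_i (*)` of type `𝐧`. -/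
def tag : Val → Val → Val
  | .inl w, v => .inl (tag w v)
  | .inr _, v => .inr v
  | _, v => v

/-- Extends an environment by a value for a new last variable. -/
def cons (v : Val) (γ : ℕ → Val) : ℕ → Val
  | 0 => v
  | i + 1 => γ i

@[simp] lemma cons_zero (v : Val) (γ : ℕ → Val) : cons v γ 0 = v := rfl

@[simp] lemma cons_succ (v : Val) (γ : ℕ → Val) (i : ℕ) : cons v γ (i + 1) = γ i := rfl

/-- The part of a measure that lives on left injections. -/
noncomputable def leftPart (μ : Val →₀ ℝ) : Val →₀ ℝ := bind μ (onSum dirac fun _ => 0)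

namespace Term

/-- The interpretation of a term: given values of its variables, a finitely supported measure on
values. All clauses except `norm` are linear in the interpretations of the subterms that may share
variables; so `ovee` subtracts the superfluous mass at `fail` instead of taking what is missing
to `1`. Both agree on probability measures. -/
noncomputable def sem : Term → (ℕ → Val) → Val →₀ ℝ
  | var i, γ => dirac (γ i)
  | star, _ => dirac .star
  | pair s t, γ => bind (s.sem γ) fun v => bind (t.sem γ) fun w => dirac (.pair v w)
  | letPair s t, γ => bind (s.sem γ) (onPair fun v w => t.sem (cons w (cons v γ)))
  | magic _, _ => 0
  | inl t, γ => bind (t.sem γ) fun v => dirac (.inl v)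
  | inr t, γ => bind (t.sem γ) fun v => dirac (.inr v)
  | caseOf r s t, γ =>
    bind (r.sem γ) (onSum (fun v => s.sem (cons v γ)) fun v => t.sem (cons v γ))
  | inlr s t, γ =>
    bind (s.sem γ) (onSum (fun v => dirac (.inl v)) fun _ => 0) +
      bind (t.sem γ) (onSum (fun v => dirac (.inr v)) fun _ => 0)
  | left t, γ => leftPart (t.sem γ)
  | instr t s, γ => bind (s.sem γ) fun v => bind (t.sem (cons v γ)) fun w => dirac (tag w v)
  | recip n, _ => (1 / n : ℝ) • dirac (.inl .star) + (1 - 1 / n : ℝ) • dirac (.inr .star)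
  | bound m n, _ =>
    (m / n : ℝ) • dirac (.inl (.inl .star)) + (1 / n : ℝ) • dirac (.inl (.inr .star)) +
      (1 - (m + 1) / n : ℝ) • dirac (.inr .star)
  | norm t, γ => (mass (leftPart (t.sem γ)))⁻¹ • leftPart (t.sem γ)
  | ovee s t, γ => s.sem γ + t.sem γ - mass (s.sem γ) • dirac (.inr .star)

end Term

lemma cons_comp_liftR (v : Val) (γ : ℕ → Val) (ρ : ℕ → ℕ) :
    (fun i => cons v γ (liftR ρ i)) = cons v fun i => γ (ρ i) := by
  funext i; cases i <;> rfl

lemma sem_rename (t : Term) (ρ : ℕ → ℕ) (γ : ℕ → Val) :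
    (t.rename ρ).sem γ = t.sem fun i => γ (ρ i) := by
  induction t generalizing ρ γ <;> simp_all [Term.rename, Term.sem, cons_comp_liftR]

@[simp] lemma sem_shift (t : Term) (k : ℕ) (γ : ℕ → Val) :
    (t.shift k).sem γ = t.sem fun i => γ (i + k) := sem_rename ..

@[simp] lemma sem_shiftUnder (t : Term) (k : ℕ) (v : Val) (γ : ℕ → Val) :
    (t.shiftUnder k).sem (cons v γ) = t.sem (cons v fun i => γ (i + k)) := by
  rw [Term.shiftUnder, sem_rename, cons_comp_liftR]

@[simp] lemma sem_shiftUnderTwo (t : Term) (k : ℕ) (v w : Val) (γ : ℕ → Val) :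
    (t.shiftUnderTwo k).sem (cons w (cons v γ)) = t.sem (cons w (cons v fun i => γ (i + k))) := by
  rw [Term.shiftUnderTwo, sem_rename, cons_comp_liftR, cons_comp_liftR]

/-! ### Free variables and affine terms -/

namespace Term

/-- The free variables of a term. -/
def fv : Term → Set ℕ
  | var i => {i}
  | star | recip _ | bound _ _ => ∅
  | pair s t | inlr s t | ovee s t => s.fv ∪ t.fv
  | letPair s t => s.fv ∪ {i | i + 2 ∈ t.fv}
  | magic t | inl t | inr t | left t | norm t => t.fv
  | caseOf r s t => r.fv ∪ {i | i + 1 ∈ s.fv ∨ i + 1 ∈ t.fv}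
  | instr t s => {i | i + 1 ∈ t.fv} ∪ s.fv

/-- Affine terms: no variable is used in two subterms that are run one after the other. The
subterms of `inlr` and `ovee` and the two branches of a case distinction may share variables. -/
def Affine : Term → Prop
  | var _ | star | recip _ | bound _ _ => True
  | pair s t => s.Affine ∧ t.Affine ∧ ∀ i ∈ s.fv, i ∉ t.fv
  | inlr s t | ovee s t => s.Affine ∧ t.Affine
  | letPair s t => s.Affine ∧ t.Affine ∧ ∀ i ∈ s.fv, i + 2 ∉ t.fv
  | magic t | inl t | inr t | left t => t.Affine
  | norm t => t.Affine ∧ ∀ i, i ∉ t.fv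
  | caseOf r s t =>
    r.Affine ∧ s.Affine ∧ t.Affine ∧ ∀ i ∈ r.fv, i + 1 ∉ s.fv ∧ i + 1 ∉ t.fv
  | instr t s => t.Affine ∧ s.Affine ∧ ∀ i, i + 1 ∉ t.fv

end Term

lemma sem_congr {t : Term} {γ δ : ℕ → Val} (h : ∀ i ∈ t.fv, γ i = δ i) : t.sem γ = t.sem δ := by
  have hc : ∀ {v : Val} {γ δ : ℕ → Val} {S : Set ℕ}, (∀ i, i + 1 ∈ S → γ i = δ i) →
      ∀ i ∈ S, cons v γ i = cons v δ i := by
    rintro v γ δ S h (_ | i) hi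
    exacts [rfl, h i hi]
  induction t generalizing γ δ with
  | var i => simp_all [Term.fv, Term.sem]
  | star | recip | bound | magic => rfl
  | inl t ih | inr t ih | left t ih | norm t ih => simp only [Term.sem, ih h]
  | pair s t ihs iht | inlr s t ihs iht | ovee s t ihs iht =>
    simp only [Term.sem, ihs fun i hi => h i (.inl hi), iht fun i hi => h i (.inr hi)]
  | letPair s t ihs iht =>
    simp only [Term.sem, ihs fun i hi => h i (.inl hi)]
    congr 2
    funext v w
    exact iht (hc (hc fun i hi => h i (.inr hi)))
  | caseOf r s t ihr ihs iht =>
    simp only [Term.sem, ihr fun i hi => h i (.inl hi)]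
    congr 2 <;> funext v
    exacts [ihs (hc fun i hi => h i (.inr (.inl hi))), iht (hc fun i hi => h i (.inr (.inr hi)))]
  | instr t s iht ihs =>
    simp only [Term.sem, ihs fun i hi => h i (.inr hi)]
    congr 1
    funext v
    rw [iht (hc fun i hi => h i (.inl hi))]

lemma mem_fv_rename (t : Term) (ρ : ℕ → ℕ) (i : ℕ) :
    i ∈ (t.rename ρ).fv ↔ ∃ j ∈ t.fv, ρ j = i := by
  have hl : ∀ (S : Set ℕ) (ρ : ℕ → ℕ) (i : ℕ),
      (∃ j ∈ S, liftR ρ j = i + 1) ↔ ∃ j, j + 1 ∈ S ∧ ρ j = i := by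
    refine fun S ρ i => ⟨?_, fun ⟨j, hj, h⟩ => ⟨j + 1, hj, by simp [liftR, h]⟩⟩
    rintro ⟨_ | j, hj, h⟩
    · simp [liftR] at h
    · exact ⟨j, hj, by simpa [liftR] using h⟩
  induction t generalizing ρ i with
  | var => simp [Term.rename, Term.fv, eq_comm]
  | star | recip | bound => simp [Term.rename, Term.fv]
  | letPair s t ihs iht =>
    have := hl t.fv (liftR ρ) (i + 1)
    have := hl {j | j + 1 ∈ t.fv} ρ i
    simp_all [Term.rename, Term.fv, or_and_right, exists_or]
  | _ => simp_all [Term.rename, Term.fv, or_and_right, exists_or]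

lemma liftR_injective {ρ : ℕ → ℕ} (h : ρ.Injective) : (liftR ρ).Injective := by
  rintro (_ | i) (_ | j) hij <;> simp_all [liftR, h.eq_iff]

lemma Term.Affine.rename {t : Term} {ρ : ℕ → ℕ} (ht : t.Affine) (h : ρ.Injective) :
    (t.rename ρ).Affine := by
  have hl : ∀ {ρ : ℕ → ℕ}, ρ.Injective → ∀ i j, liftR ρ i = ρ j + 1 ↔ i = j + 1 :=
    fun h i j => (liftR_injective h).eq_iff (b := j + 1)
  induction t generalizing ρ with
  | var | star | recip | bound => trivial
  | inl t ih | inr t ih | left t ih | magic t ih => exact ih ht h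
  | inlr s t ihs iht | ovee s t ihs iht => exact ⟨ihs ht.1 h, iht ht.2 h⟩
  | norm t ih => exact ⟨ih ht.1 h, fun i hi => by
      obtain ⟨j, hj, -⟩ := (mem_fv_rename ..).1 hi
      exact ht.2 j hj⟩
  | instr t s iht ihs =>
    refine ⟨iht ht.1 (liftR_injective h), ihs ht.2.1 h, fun i hi => ?_⟩
    obtain ⟨_ | j, hj, hji⟩ := (mem_fv_rename ..).1 hi
    · simp [liftR] at hji
    · exact ht.2.2 j hj
  | pair s t ihs iht =>
    refine ⟨ihs ht.1 h, iht ht.2.1 h, fun i hi hi' => ?_⟩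
    obtain ⟨j, hj, rfl⟩ := (mem_fv_rename ..).1 hi
    obtain ⟨k, hk, hkj⟩ := (mem_fv_rename ..).1 hi'
    exact ht.2.2 j hj (h hkj ▸ hk)
  | letPair s t ihs iht =>
    refine ⟨ihs ht.1 h, iht ht.2.1 (liftR_injective (liftR_injective h)), fun i hi hi' => ?_⟩
    obtain ⟨j, hj, rfl⟩ := (mem_fv_rename ..).1 hi
    obtain ⟨k, hk, hkj⟩ := (mem_fv_rename ..).1 hi'
    obtain rfl : k = j + 2 := liftR_injective (liftR_injective h) (a₂ := j + 2) hkj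
    exact ht.2.2 j hj hk
  | caseOf r s t ihr ihs iht =>
    refine ⟨ihr ht.1 h, ihs ht.2.1 (liftR_injective h), iht ht.2.2.1 (liftR_injective h),
      fun i hi => ?_⟩
    obtain ⟨j, hj, rfl⟩ := (mem_fv_rename ..).1 hi
    constructor <;> intro hi' <;> obtain ⟨k, hk, hkj⟩ := (mem_fv_rename ..).1 hi' <;>
      obtain rfl : k = j + 1 := liftR_injective h (a₂ := j + 1) hkj
    exacts [(ht.2.2.2 j hj).1 hk, (ht.2.2.2 j hj).2 hk]

/-! ### The substitution lemma -/

lemma mem_fv_liftS (S : Set ℕ) (σ : ℕ → Term) (i : ℕ) :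
    (∃ j ∈ S, i + 1 ∈ (liftS σ j).fv) ↔ ∃ j, j + 1 ∈ S ∧ i ∈ (σ j).fv := by
  have hs (j : ℕ) : i + 1 ∈ (liftS σ (j + 1)).fv ↔ i ∈ (σ j).fv := by
    simp [liftS, Term.shift, mem_fv_rename]
  refine ⟨?_, fun ⟨j, hj, h⟩ => ⟨j + 1, hj, (hs j).2 h⟩⟩
  rintro ⟨_ | j, hj, h⟩
  · simp [liftS, Term.fv] at h
  · exact ⟨j, hj, (hs j).1 h⟩

lemma mem_fv_subst (t : Term) (σ : ℕ → Term) (i : ℕ) :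
    i ∈ (t.subst σ).fv ↔ ∃ j ∈ t.fv, i ∈ (σ j).fv := by
  induction t generalizing σ i with
  | var | star | recip | bound => simp [Term.subst, Term.fv]
  | letPair s t ihs iht =>
    have := mem_fv_liftS t.fv (liftS σ) (i + 1)
    have := mem_fv_liftS {j | j + 1 ∈ t.fv} σ i
    simp_all [Term.subst, Term.fv, or_and_right, exists_or]
  | _ => simp_all [Term.subst, Term.fv, or_and_right, exists_or, mem_fv_liftS]

/-- Substituting affine terms that share no variables for the variables in `S`. -/
def AffineSubst (S : Set ℕ) (σ : ℕ → Term) : Prop :=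
  (∀ i ∈ S, (σ i).Affine) ∧ ∀ i ∈ S, ∀ j ∈ S, ∀ k, k ∈ (σ i).fv → k ∈ (σ j).fv → i = j

lemma AffineSubst.mono {S T : Set ℕ} {σ : ℕ → Term} (h : AffineSubst S σ) (hT : T ⊆ S) :
    AffineSubst T σ :=
  ⟨fun i hi => h.1 i (hT hi), fun i hi j hj => h.2 i (hT hi) j (hT hj)⟩

lemma AffineSubst.liftS {S : Set ℕ} {σ : ℕ → Term} (h : AffineSubst {i | i + 1 ∈ S} σ) :
    AffineSubst S (liftS σ) := by
  refine ⟨?_, ?_⟩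
  · rintro (_ | i) hi
    · trivial
    · exact (h.1 i hi).rename (add_left_injective 1)
  · have h0 (i k : ℕ) : k ∈ (COMET.liftS σ (i + 1)).fv ↔ ∃ l ∈ (σ i).fv, l + 1 = k := by
      simp [COMET.liftS, Term.shift, mem_fv_rename]
    rintro (_ | i) hi (_ | j) hj k hki hkj
    · rfl
    · obtain ⟨l, -, rfl⟩ := (h0 ..).1 hkj
      simp [COMET.liftS, Term.fv] at hki
    · obtain ⟨l, -, rfl⟩ := (h0 ..).1 hki
      simp [COMET.liftS, Term.fv] at hkj
    · obtain ⟨l, hl, rfl⟩ := (h0 ..).1 hki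
      obtain ⟨l', hl', hll⟩ := (h0 ..).1 hkj
      obtain rfl : l' = l := by omega
      rw [h.2 i hi j hj l' hl hl']

lemma Term.Affine.subst {t : Term} {σ : ℕ → Term} (ht : t.Affine) (h : AffineSubst t.fv σ) :
    (t.subst σ).Affine := by
  induction t generalizing σ with
  | var i => exact h.1 i rfl
  | star | recip | bound => trivial
  | inl t ih | inr t ih | left t ih | magic t ih => exact ih ht h
  | inlr s t ihs iht | ovee s t ihs iht =>
    exact ⟨ihs ht.1 (h.mono Set.subset_union_left), iht ht.2 (h.mono Set.subset_union_right)⟩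
  | norm t ih => exact ⟨ih ht.1 h, fun i hi => by
      obtain ⟨j, hj, -⟩ := (mem_fv_subst ..).1 hi
      exact ht.2 j hj⟩
  | instr t s iht ihs =>
    refine ⟨iht ht.1 (h.mono Set.subset_union_left).liftS,
      ihs ht.2.1 (h.mono Set.subset_union_right), fun i hi => ?_⟩
    obtain ⟨j, hj, -⟩ := (mem_fv_liftS ..).1 ((mem_fv_subst ..).1 hi)
    exact ht.2.2 j hj
  | pair s t ihs iht =>
    refine ⟨ihs ht.1 (h.mono Set.subset_union_left), iht ht.2.1 (h.mono Set.subset_union_right),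
      fun i hi hi' => ?_⟩
    obtain ⟨j, hj, hij⟩ := (mem_fv_subst ..).1 hi
    obtain ⟨k, hk, hik⟩ := (mem_fv_subst ..).1 hi'
    exact ht.2.2 j hj (h.2 j (.inl hj) k (.inr hk) i hij hik ▸ hk)
  | letPair s t ihs iht =>
    refine ⟨ihs ht.1 (h.mono Set.subset_union_left),
      iht ht.2.1 (AffineSubst.liftS (AffineSubst.liftS (h.mono Set.subset_union_right))),
      fun i hi hi' => ?_⟩
    obtain ⟨j, hj, hij⟩ := (mem_fv_subst ..).1 hi
    obtain ⟨k, hk, hik⟩ := (mem_fv_liftS {j | j + 1 ∈ t.fv} ..).1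
      ((mem_fv_liftS ..).1 ((mem_fv_subst ..).1 hi'))
    exact ht.2.2 j hj (h.2 j (.inl hj) k (.inr hk) i hij hik ▸ hk)
  | caseOf r s t ihr ihs iht =>
    refine ⟨ihr ht.1 (h.mono Set.subset_union_left),
      ihs ht.2.1 (AffineSubst.liftS (h.mono fun i hi => .inr (.inl hi))),
      iht ht.2.2.1 (AffineSubst.liftS (h.mono fun i hi => .inr (.inr hi))), fun i hi => ?_⟩
    obtain ⟨j, hj, hij⟩ := (mem_fv_subst ..).1 hi
    constructor <;> intro hi' <;>
      obtain ⟨k, hk, hik⟩ := (mem_fv_liftS ..).1 ((mem_fv_subst ..).1 hi')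
    · exact (ht.2.2.2 j hj).1 (h.2 j (.inl hj) k (.inr (.inl hk)) i hij hik ▸ hk)
    · exact (ht.2.2.2 j hj).2 (h.2 j (.inl hj) k (.inr (.inr hk)) i hij hik ▸ hk)

/-- A random environment with independent coordinates, of total mass `1`. Independence is stated
in the form in which the substitution lemma needs it: running two computations that look at
disjoint sets of coordinates one after the other may as well be done with separate copies of the
environment. -/
structure Indep (P : (ℕ → Val) →₀ ℝ) : Prop where
  mass_eq : mass P = 1
  bind_bind : ∀ (S T : Set ℕ), Disjoint S T → ∀ (F : (ℕ → Val) → Val →₀ ℝ)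
    (G : Val → (ℕ → Val) → Val →₀ ℝ), DependsOn F S → (∀ w, DependsOn (G w) T) →
      (bind (bind P F) fun w => bind P (G w)) = bind P fun e => bind (F e) fun w => G w e

lemma Indep.dirac (γ : ℕ → Val) : Indep (dirac γ) := ⟨by simp, by simp⟩

/-- The random environment `P`, extended by an independent value with distribution `ν`. -/
noncomputable def consLaw (ν : Val →₀ ℝ) (P : (ℕ → Val) →₀ ℝ) : (ℕ → Val) →₀ ℝ :=
  bind ν fun v => bind P fun e => COMET.dirac (cons v e)

lemma bind_consLaw {E : Type*} [AddCommGroup E] [Module ℝ E] (ν : Val →₀ ℝ)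
    (P : (ℕ → Val) →₀ ℝ) (f : (ℕ → Val) → E) :
    bind (consLaw ν P) f = bind ν fun v => bind P fun e => f (cons v e) := by
  simp [consLaw, bind_bind]

lemma DependsOn.cons {β : Type*} {F : (ℕ → Val) → β} {S : Set ℕ} (h : DependsOn F S) (v : Val) :
    DependsOn (fun e => F (cons v e)) {i | i + 1 ∈ S} := by
  intro x y hxy
  refine h ?_
  rintro (_ | i) hi
  exacts [rfl, hxy i hi]

lemma DependsOn.cons_eq {β : Type*} {F : (ℕ → Val) → β} {S : Set ℕ} (h : DependsOn F S)
    (h0 : 0 ∉ S) (v w : Val) (e : ℕ → Val) : F (COMET.cons v e) = F (COMET.cons w e) := by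
  refine h ?_
  rintro (_ | i) hi
  exacts [(h0 hi).elim, rfl]

lemma Indep.consLaw {P : (ℕ → Val) →₀ ℝ} (hP : Indep P) {ν : Val →₀ ℝ} (hν : mass ν = 1) :
    Indep (consLaw ν P) := by
  refine ⟨?_, fun S T hST F G hF hG => ?_⟩
  · have := hP.mass_eq
    unfold mass at this hν ⊢
    simp [bind_consLaw, this, hν]
  have hST' : Disjoint {i | i + 1 ∈ S} {i | i + 1 ∈ T} :=
    Set.disjoint_left.2 fun i hi => Set.disjoint_left.1 hST hi
  simp only [bind_consLaw]
  -- The new coordinate is looked at by at most one of the two computations.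
  by_cases h0 : 0 ∈ S
  · have h0 : 0 ∉ T := Set.disjoint_left.1 hST h0
    have hG' (w v : Val) (e : ℕ → Val) : G w (cons v e) = G w (cons .star e) :=
      DependsOn.cons_eq (hG w) h0 ..
    simp only [hG', bind_const, hν, one_smul]
    rw [COMET.bind_bind]
    congr 1
    funext v
    exact hP.bind_bind _ _ hST' _ _ (DependsOn.cons hF v) fun w => DependsOn.cons (hG w) _
  · have hF' (v : Val) (e : ℕ → Val) : F (cons v e) = F (cons .star e) :=
      DependsOn.cons_eq hF h0 ..
    simp only [hF', bind_const, hν, one_smul]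
    rw [bind_comm]
    congr 1
    funext v
    exact hP.bind_bind _ _ hST' _ _ (DependsOn.cons hF _) fun w => DependsOn.cons (hG w) _

lemma onPair_bind {E X : Type*} [AddCommGroup E] [Module ℝ E] (μ : X →₀ ℝ)
    (f : X → Val → Val → E) :
    (onPair fun v w => bind μ fun x => f x v w) = fun u => bind μ fun x => onPair (f x) u := by
  funext u; cases u <;> simp [onPair]

lemma onSum_bind {E X : Type*} [AddCommGroup E] [Module ℝ E] (μ : X →₀ ℝ) (f g : X → Val → E) :
    (onSum (fun v => bind μ fun x => f x v) fun v => bind μ fun x => g x v) =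
      fun u => bind μ fun x => onSum (f x) (g x) u := by
  funext u; cases u <;> simp [onSum]

lemma dependsOn_sem (t : Term) : DependsOn t.sem t.fv := fun _ _ h => sem_congr h

/-- The random environment `P` has the interpretations of the terms `σ i` as marginals. -/
def Marginals (σ : ℕ → Term) (γ : ℕ → Val) (P : (ℕ → Val) →₀ ℝ) : Prop :=
  ∀ i, (σ i).sem γ = bind P fun e => dirac (e i)

lemma Marginals.liftS {σ : ℕ → Term} {γ : ℕ → Val} {P : (ℕ → Val) →₀ ℝ} (h : Marginals σ γ P)
    (hP : Indep P) (v : Val) : Marginals (liftS σ) (cons v γ) (consLaw (dirac v) P) := by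
  rintro (_ | i)
  · simp [COMET.liftS, Term.sem, bind_consLaw, bind_const, hP.mass_eq]
  · simpa [COMET.liftS, bind_consLaw] using h i

/-- The substitution lemma. Affinity is essential: a term that is substituted for a variable used
twice would be run twice, with independent outcomes. -/
lemma sem_subst {t : Term} (ht : t.Affine) {σ : ℕ → Term} {γ : ℕ → Val} {P : (ℕ → Val) →₀ ℝ}
    (hP : Indep P) (h : Marginals σ γ P) : (t.subst σ).sem γ = bind P t.sem := by
  have hstep {t : Term} (ih : ∀ {σ : ℕ → Term} {γ : ℕ → Val} {P : (ℕ → Val) →₀ ℝ},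
      Indep P → Marginals σ γ P → (t.subst σ).sem γ = bind P t.sem)
      {σ : ℕ → Term} {γ : ℕ → Val} {P : (ℕ → Val) →₀ ℝ} (hP : Indep P) (h : Marginals σ γ P)
      (v : Val) : (t.subst (liftS σ)).sem (cons v γ) = bind P fun e => t.sem (cons v e) := by
    rw [ih (hP.consLaw (mass_dirac v)) (h.liftS hP v), bind_consLaw, bind_dirac_left]
  have hconst {f : (ℕ → Val) → Val →₀ ℝ} {S : Set ℕ} (hf : DependsOn f S) (hS : ∀ i, i ∉ S)
      {P : (ℕ → Val) →₀ ℝ} (hP : Indep P) (γ : ℕ → Val) : bind P f = f γ := by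
    rw [show f = fun _ => f γ from funext fun e => hf fun i hi => (hS i hi).elim, bind_const,
      hP.mass_eq, one_smul]
  induction t generalizing σ γ P with
  | var i => exact h i
  | star | recip | bound => simp only [Term.subst, Term.sem, bind_const, hP.mass_eq, one_smul]
  | magic => simp [Term.subst, Term.sem]
  | inl t ih | inr t ih | left t ih =>
    simp only [Term.subst, Term.sem, leftPart, ih ht hP h, bind_bind]
  | inlr s t ihs iht =>
    simp only [Term.subst, Term.sem, ihs ht.1 hP h, iht ht.2 hP h, bind_bind, ← bind_add_right]
  | ovee s t ihs iht =>
    simp only [Term.subst, Term.sem, ihs ht.1 hP h, iht ht.2 hP h, mass_bind, sub_eq_add_neg,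
      bind_add_right, ← neg_smul]
    rw [← neg_one_mul, mul_smul]
    simp only [← neg_one_mul (mass _), mul_smul]
    rw [← smul_bind]
    congr 2
    exact map_bind (LinearMap.toSpanSingleton ℝ (Val →₀ ℝ) (dirac (.inr .star))) P _
  | norm t ih =>
    simp only [Term.subst, Term.sem, ih ht.1 hP h]
    rw [hconst (dependsOn_sem t) ht.2 hP γ]
    refine (hconst (f := fun e => (mass (leftPart (t.sem e)))⁻¹ • leftPart (t.sem e))
      (S := t.fv) (fun x y hxy => ?_) ht.2 hP γ).symm
    simp only [dependsOn_sem t hxy]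
  | instr t s iht ihs =>
    simp only [Term.subst, Term.sem, ihs ht.2.1 hP h, hstep (iht ht.1) hP h, bind_bind]
    congr 1
    funext e
    congr 1
    funext v
    rw [← bind_bind, hconst (S := {i | i + 1 ∈ t.fv}) ?_ ht.2.2 hP e]
    exact DependsOn.cons (dependsOn_sem t) v
  | pair s t ihs iht =>
    simp only [Term.subst, Term.sem, ihs ht.1 hP h, iht ht.2.1 hP h]
    simp only [bind_bind P]
    rw [← bind_bind]
    exact hP.bind_bind _ _ (Set.disjoint_left.2 ht.2.2) s.sem
      (fun v e => bind (t.sem e) fun w => dirac (.pair v w)) (dependsOn_sem s)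
      fun v x y hxy => by simp only [dependsOn_sem t hxy]
  | letPair s t ihs iht =>
    have ht' (v w : Val) : (t.subst (liftS (liftS σ))).sem (cons w (cons v γ)) =
        bind P fun e => t.sem (cons w (cons v e)) := by
      rw [hstep (iht ht.2.1) (hP.consLaw (mass_dirac v)) (h.liftS hP v), bind_consLaw,
        bind_dirac_left]
    simp only [Term.subst, Term.sem, ihs ht.1 hP h, ht', onPair_bind]
    refine hP.bind_bind _ _ (Set.disjoint_left.2 ht.2.2) s.sem
      (fun u e => onPair (fun v w => t.sem (cons w (cons v e))) u) (dependsOn_sem s)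
      fun u x y hxy => ?_
    cases u <;> simp only [onPair]
    exact DependsOn.cons (DependsOn.cons (dependsOn_sem t) _) _ hxy
  | caseOf r s t ihr ihs iht =>
    simp only [Term.subst, Term.sem, ihr ht.1 hP h, hstep (ihs ht.2.1) hP h,
      hstep (iht ht.2.2.1) hP h, onSum_bind]
    refine hP.bind_bind _ {i | i + 1 ∈ s.fv ∨ i + 1 ∈ t.fv}
      (Set.disjoint_left.2 fun i hi hi' => hi'.elim (ht.2.2.2 i hi).1 (ht.2.2.2 i hi).2) r.sem
      (fun u e => onSum (fun v => s.sem (cons v e)) (fun v => t.sem (cons v e)) u)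
      (dependsOn_sem r) fun u x y hxy => ?_
    cases u <;> simp only [onSum]
    · exact DependsOn.cons (dependsOn_sem s) _ fun i hi => hxy i (.inl hi)
    · exact DependsOn.cons (dependsOn_sem t) _ fun i hi => hxy i (.inr hi)

lemma sem_inst {t r : Term} (ht : t.Affine) {γ : ℕ → Val} (hr : mass (r.sem γ) = 1) :
    (t.inst r).sem γ = bind (r.sem γ) fun v => t.sem (cons v γ) := by
  rw [Term.inst, sem_subst ht ((Indep.dirac γ).consLaw hr) ?_, bind_consLaw]
  · simp
  · rintro (_ | i)
    · simp [bind_consLaw]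
    · simp [bind_consLaw, Term.sem, bind_const, hr]

lemma sem_instTwo {t r s : Term} (ht : t.Affine) {γ : ℕ → Val} (hr : mass (r.sem γ) = 1)
    (hs : mass (s.sem γ) = 1) :
    (t.instTwo r s).sem γ =
      bind (r.sem γ) fun v => bind (s.sem γ) fun w => t.sem (cons w (cons v γ)) := by
  rw [Term.instTwo, sem_subst ht (((Indep.dirac γ).consLaw hr).consLaw hs) ?_]
  · simp only [bind_consLaw, bind_dirac_left]
    rw [bind_comm]
  · rintro (_ | _ | i)
    · simp [bind_consLaw, bind_const, ((Indep.dirac γ).consLaw hr).mass_eq]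
    · simp [bind_consLaw, bind_const, hs]
    · simp [bind_consLaw, Term.sem, bind_const, hr, hs]

/-! ### The interpretation of types and judgements -/

/-- The values of a type. A type constant is interpreted as a one-point set. -/
def Ty.Has {C : Type u} : Ty C → Val → Prop
  | .const _, v => v = .star
  | .empty, _ => False
  | .unit, v => v = .star
  | .sum A _, .inl a => A.Has a
  | .sum _ B, .inr b => B.Has b
  | .sum _ _, _ => False
  | .tensor A B, .pair a b => A.Has a ∧ B.Has b
  | .tensor _ _, _ => False

/-- Probability distributions on the values of the type `A`. -/
structure IsDist {C : Type u} (A : Ty C) (μ : Val →₀ ℝ) : Prop where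
  nonneg : ∀ v, 0 ≤ μ v
  has : ∀ v, μ v ≠ 0 → A.Has v
  mass_eq : mass μ = 1

/-- `γ` assigns to each variable of `Γ` a value of its type. -/
def EnvOf {C : Type u} (Γ : Ctx C) (γ : ℕ → Val) : Prop :=
  ∀ (i : ℕ) (A : Ty C), Γ[i]? = some A → A.Has (γ i)

/-- The interpretation of `Γ ⊢ t : A`. Besides saying that `t` denotes a probability distribution
on `A`, it records that `t` is affine, as the substitution lemma requires. -/
structure Typed {C : Type u} (Γ : Ctx C) (t : Term) (A : Ty C) : Prop where
  affine : t.Affine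
  fv_lt : ∀ i ∈ t.fv, i < Γ.length
  dist : ∀ γ, EnvOf Γ γ → IsDist A (t.sem γ)

/-- The interpretation of `Γ ⊢ s = t : A`. -/
structure Equal {C : Type u} (Γ : Ctx C) (s t : Term) (A : Ty C) : Prop where
  left : Typed Γ s A
  right : Typed Γ t A
  sem_eq : ∀ γ, EnvOf Γ γ → s.sem γ = t.sem γ

/-- Validity of judgements in the model. For `s ≤ t` only the resulting inequality between the
probabilities of defined values is kept; it is what the normalisation rules need. -/
def Valid {C : Type u} (Γ : Ctx C) : Stmt C → Prop
  | .hasType t A => Typed Γ t A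
  | .eq s t A => Equal Γ s t A
  | .le s t _ => ∀ γ, EnvOf Γ γ → ∀ v, s.sem γ (.inl v) ≤ t.sem γ (.inl v)

variable {C : Type u} {Γ Δ Θ : Ctx C} {A B D E F : Ty C} {γ : ℕ → Val} {μ ν : Val →₀ ℝ}

lemma Equal.of_left {s t : Term} (hs : Typed Γ s A) (ht : t.Affine) (hf : ∀ i ∈ t.fv, i < Γ.length)
    (h : ∀ γ, EnvOf Γ γ → s.sem γ = t.sem γ) : Equal Γ s t A :=
  ⟨hs, ⟨ht, hf, fun γ hγ => h γ hγ ▸ hs.dist γ hγ⟩, h⟩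

lemma Equal.symm {s t : Term} (h : Equal Γ s t A) : Equal Γ t s A :=
  ⟨h.right, h.left, fun γ hγ => (h.sem_eq γ hγ).symm⟩

lemma EnvOf.cons {v : Val} (hγ : EnvOf Γ γ) (hv : A.Has v) : EnvOf (A :: Γ) (cons v γ) := by
  rintro (_ | i) B hB
  · simp at hB; exact hB ▸ hv
  · exact hγ i B (by simpa using hB)

lemma envOf_nil (γ : ℕ → Val) : EnvOf ([] : Ctx C) γ := fun i A h => by simp at h

lemma EnvOf.singleton {v : Val} (hv : A.Has v) : EnvOf [A] (COMET.cons v γ) := (envOf_nil γ).cons hv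

lemma EnvOf.left (h : EnvOf (Δ ++ Γ) γ) : EnvOf Δ γ := fun i A hA => h i A <| by
  rw [List.getElem?_append_left (List.getElem?_eq_some_iff.1 hA).1, hA]

lemma EnvOf.right (h : EnvOf (Δ ++ Γ) γ) : EnvOf Γ fun i => γ (i + Δ.length) :=
  fun i A hA => h _ A <| by rw [List.getElem?_append_right (by omega)]; simpa using hA

lemma EnvOf.swap (h : EnvOf (Δ ++ A :: B :: Γ) γ) :
    EnvOf (Δ ++ B :: A :: Γ) fun i => γ (Equiv.swap Δ.length (Δ.length + 1) i) := by
  intro i D hD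
  refine h _ D ?_
  rcases lt_trichotomy i Δ.length with hi | rfl | hi
  · rw [Equiv.swap_apply_of_ne_of_ne (by omega) (by omega), List.getElem?_append_left hi]
    rwa [List.getElem?_append_left hi] at hD
  · simpa using hD
  · rw [List.getElem?_append_right (by omega)] at hD
    obtain ⟨k, rfl⟩ := Nat.exists_eq_add_of_lt hi
    rcases k with _ | k
    · simpa using hD
    · rw [Equiv.swap_apply_of_ne_of_ne (by omega) (by omega),
        List.getElem?_append_right (by omega)]
      simpa [show Δ.length + (k + 1) + 1 - Δ.length = k + 2 by omega] using hD

/-! ### Probability distributions on types -/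

lemma dirac_injective_apply {X Y : Type*} {f : X → Y} (hf : f.Injective) (x y : X) :
    dirac (f x) (f y) = dirac x y := by
  classical simp [dirac, Finsupp.single_apply, hf.eq_iff]

@[simp] lemma dirac_inl_inl (v w : Val) : dirac (Val.inl v) (.inl w) = dirac v w :=
  dirac_injective_apply (fun _ _ => Val.inl.inj) v w

@[simp] lemma dirac_inr_inr (v w : Val) : dirac (Val.inr v) (.inr w) = dirac v w :=
  dirac_injective_apply (fun _ _ => Val.inr.inj) v w

@[simp] lemma dirac_inl_inr (v w : Val) : dirac (Val.inl v) (.inr w) = 0 :=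
  dirac_apply_of_ne (by simp)

@[simp] lemma dirac_inr_inl (v w : Val) : dirac (Val.inr v) (.inl w) = 0 :=
  dirac_apply_of_ne (by simp)

lemma leftPart_apply (μ : Val →₀ ℝ) (v : Val) : leftPart μ v = μ (.inl v) := by
  rw [leftPart, bind_apply]
  refine bind_eq_apply fun u => ?_
  cases u
  · exact (dirac_apply_of_ne (by simp)).symm
  · exact (dirac_apply_of_ne (by simp)).symm
  all_goals simp [onSum]

lemma isDist_dirac {v : Val} (hv : A.Has v) : IsDist A (dirac v) := by
  refine ⟨fun w => ?_, fun w hw => ?_, mass_dirac v⟩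
  · by_cases h : v = w
    · rw [h, dirac_apply_self]; exact zero_le_one
    · rw [dirac_apply_of_ne h]
  · by_cases h : v = w
    · exact h ▸ hv
    · exact (hw (dirac_apply_of_ne h)).elim

lemma IsDist.bind {f : Val → Val →₀ ℝ} (hμ : IsDist A μ) (hf : ∀ v, A.Has v → IsDist B (f v)) :
    IsDist B (bind μ f) := by
  refine ⟨fun w => ?_, fun w hw => ?_, ?_⟩
  · rw [bind_apply]
    exact bind_nonneg hμ.nonneg fun v hv => (hf v (hμ.has v hv)).nonneg w
  · by_contra h
    refine hw ?_
    rw [bind_apply, bind_congr (g := fun _ => (0 : ℝ)), bind_zero_right]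
    intro v hv
    by_contra h'
    exact h ((hf v (hμ.has v hv)).has w h')
  · rw [mass_bind, bind_congr (g := fun _ => (1 : ℝ)) fun v hv => (hf v (hμ.has v hv)).mass_eq]
    exact hμ.mass_eq

lemma IsDist.add_smul {a b : ℝ} (ha : 0 ≤ a) (hb : 0 ≤ b) (hab : a + b = 1) (hμ : IsDist A μ)
    (hν : IsDist A ν) : IsDist A (a • μ + b • ν) := by
  refine ⟨fun v => ?_, fun v hv => ?_, by simp [hμ.mass_eq, hν.mass_eq, hab]⟩
  · exact add_nonneg (mul_nonneg ha (hμ.nonneg v)) (mul_nonneg hb (hν.nonneg v))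
  · by_cases h : μ v = 0
    · exact hν.has v fun h' => hv (by simp [h, h'])
    · exact hμ.has v h

lemma IsDist.bind_congr {F : Type*} [AddCommGroup F] [Module ℝ F] {f g : Val → F}
    (hμ : IsDist A μ) (h : ∀ v, A.Has v → f v = g v) : COMET.bind μ f = COMET.bind μ g :=
  COMET.bind_congr fun v hv => h v (hμ.has v hv)

lemma not_isDist_empty : ¬ IsDist (Ty.empty : Ty C) μ := fun h => by
  have h0 : mass μ = 0 := by
    rw [mass, h.bind_congr (g := fun _ => (0 : ℝ)) fun v hv => hv.elim, bind_zero_right]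
  exact one_ne_zero (h.mass_eq.symm.trans h0)

lemma IsDist.eq_dirac (h : IsDist (Ty.unit : Ty C) μ) : μ = dirac .star := by
  conv_lhs => rw [← bind_dirac_right μ]
  rw [h.bind_congr (g := fun _ => dirac .star) fun v (hv : v = .star) => hv ▸ rfl,
    bind_const, h.mass_eq, one_smul]

/-- A probability distribution on `A + 1` is determined by its part on `A`. -/
lemma IsDist.ext_partial (hμ : IsDist A.partialTy μ) (hν : IsDist A.partialTy ν)
    (h : ∀ v, μ (.inl v) = ν (.inl v)) : μ = ν := by
  have hsub : μ - ν = (μ (.inr .star) - ν (.inr .star)) • dirac (.inr .star) := by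
    have h0 (u : Val) (hu : ¬ A.partialTy.Has u) : μ u = 0 ∧ ν u = 0 :=
      ⟨by_contra fun h => hu (hμ.has u h), by_contra fun h => hu (hν.has u h)⟩
    ext u
    by_cases hu : u = .inr .star
    · simp [hu, dirac_apply_self]
    · rw [Finsupp.smul_apply, dirac_apply_of_ne (Ne.symm hu), smul_zero, Finsupp.sub_apply,
        sub_eq_zero]
      rcases u with _ | _ | v | v
      · rw [(h0 _ id).1, (h0 _ id).2]
      · rw [(h0 _ id).1, (h0 _ id).2]
      · exact h v
      · have : ¬ A.partialTy.Has (.inr v) := fun hv => hu (congrArg _ hv)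
        rw [(h0 _ this).1, (h0 _ this).2]
  have hm := congrArg mass hsub
  rw [mass_sub, hμ.mass_eq, hν.mass_eq, mass_smul, mass_dirac, mul_one, sub_self] at hm
  rwa [← hm, zero_smul, sub_eq_zero] at hsub

lemma bind_leftPart {F : Type*} [AddCommGroup F] [Module ℝ F] (μ : Val →₀ ℝ) (f : Val → F) :
    bind (leftPart μ) f = bind μ (onSum f fun _ => 0) := by
  rw [leftPart, bind_bind]
  congr 1
  funext u; cases u <;> simp [onSum]

/-! ### Elements of copowers -/

/-- The coprojections on values, with branches counted from `0` as in `Term.inj`. -/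
def injV : ℕ → ℕ → Val → Val
  | 0, _, v => v
  | 1, _, v => v
  | n + 2, i, v => if i = n + 1 then .inr v else .inl (injV (n + 1) i v)

/-- The summand of `n · A` in which a value lies. -/
def index : ℕ → Val → ℕ
  | n + 2, .inl v => index (n + 1) v
  | n + 2, .inr _ => n + 1
  | _, _ => 0

/-- The element of `A` underlying a value of `n · A`. -/
def strip : ℕ → Val → Val
  | n + 2, .inl v => strip (n + 1) v
  | _ + 2, .inr v => v
  | _, v => v

lemma has_copower_iff {n : ℕ} {u : Val} :
    (Ty.copower n A).Has u ↔ ∃ i < n, ∃ v, A.Has v ∧ u = injV n i v := by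
  induction n generalizing u with
  | zero => simp [Ty.copower, Ty.Has]
  | succ n ih =>
    rcases n with _ | n
    · simp [Ty.copower, injV]
    have hi {i : ℕ} (h : i < n + 1) (v : Val) : injV (n + 2) i v = .inl (injV (n + 1) i v) :=
      if_neg (by omega)
    have hn (v : Val) : injV (n + 2) (n + 1) v = .inr v := if_pos rfl
    constructor
    · intro hu
      rcases u with _ | _ | u | u
      · exact hu.elim
      · exact hu.elim
      · obtain ⟨i, h, v, hv, rfl⟩ := ih.1 hu
        exact ⟨i, by omega, v, hv, (hi h v).symm⟩
      · exact ⟨n + 1, by omega, u, hu, (hn u).symm⟩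
    · rintro ⟨i, h, v, hv, rfl⟩
      rcases Nat.lt_succ_iff_lt_or_eq.1 h with h | rfl
      · rw [hi h]
        exact ih.2 ⟨i, h, v, hv, rfl⟩
      · rw [hn]
        exact hv

lemma index_injV {n i : ℕ} (h : i < n) (v : Val) : index n (injV n i v) = i := by
  induction n with
  | zero => omega
  | succ n ih =>
    rcases n with _ | n
    · simp only [index]; omega
    rcases Nat.lt_succ_iff_lt_or_eq.1 h with h | rfl
    · rw [injV, if_neg (by omega), index, ih h]
    · rw [injV, if_pos rfl, index]

lemma strip_injV {n i : ℕ} (h : i < n) (v : Val) : strip n (injV n i v) = v := by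
  induction n with
  | zero => omega
  | succ n ih =>
    rcases n with _ | n
    · rfl
    rcases Nat.lt_succ_iff_lt_or_eq.1 h with h | rfl
    · rw [injV, if_neg (by omega), strip, ih h]
    · rw [injV, if_pos rfl, strip]

lemma tag_injV (n i : ℕ) (v : Val) : tag (injV n i .star) v = injV n i v := by
  induction n with
  | zero => rfl
  | succ n ih =>
    rcases n with _ | n
    · rfl
    rw [injV, injV]
    split_ifs
    · rfl
    · rw [tag, ih]

lemma sem_inj (n i : ℕ) (t : Term) (γ : ℕ → Val) :
    (Term.inj n i t).sem γ = bind (t.sem γ) fun v => dirac (injV n i v) := by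
  induction n with
  | zero => exact (bind_dirac_right _).symm
  | succ n ih =>
    rcases n with _ | n
    · exact (bind_dirac_right _).symm
    rw [Term.inj]
    simp only [injV]
    split_ifs
    · rfl
    · simp [Term.sem, ih, bind_bind]

/-! ### Validity of the typing rules -/

@[simp] lemma shift_zero (t : Term) : t.shift 0 = t := by
  have hl : liftR id = id := by funext i; cases i <;> rfl
  have h (t : Term) : t.rename id = t := by
    induction t <;> simp_all [Term.rename]
  exact h t

lemma mem_fv_shift {t : Term} {k i : ℕ} : i ∈ (t.shift k).fv ↔ k ≤ i ∧ i - k ∈ t.fv := by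
  rw [Term.shift, mem_fv_rename]
  exact ⟨by rintro ⟨j, hj, rfl⟩; simpa using hj, fun h => ⟨_, h.2, Nat.sub_add_cancel h.1⟩⟩

lemma mem_fv_shiftUnder {t : Term} {k i : ℕ} :
    i ∈ (t.shiftUnder k).fv ↔ i = 0 ∧ 0 ∈ t.fv ∨ k + 1 ≤ i ∧ i - k ∈ t.fv := by
  rw [Term.shiftUnder, mem_fv_rename]
  constructor
  · rintro ⟨_ | j, hj, rfl⟩
    · exact .inl ⟨rfl, hj⟩
    · exact .inr ⟨by simp [liftR], by simpa [liftR, show j + k + 1 - k = j + 1 by omega] using hj⟩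
  · rintro (⟨rfl, h⟩ | ⟨h, h'⟩)
    · exact ⟨0, h, rfl⟩
    · obtain ⟨j, rfl⟩ := Nat.exists_eq_add_of_le h
      exact ⟨j + 1, by simpa [show k + 1 + j - k = j + 1 by omega] using h', by
        simp only [liftR]; omega⟩

lemma mem_fv_shiftUnderTwo {t : Term} {k i : ℕ} :
    i ∈ (t.shiftUnderTwo k).fv ↔ i < 2 ∧ i ∈ t.fv ∨ k + 2 ≤ i ∧ i - k ∈ t.fv := by
  rw [Term.shiftUnderTwo, mem_fv_rename]
  constructor
  · rintro ⟨_ | _ | j, hj, rfl⟩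
    · exact .inl ⟨by simp [liftR], hj⟩
    · exact .inl ⟨by simp [liftR], hj⟩
    · exact .inr ⟨by simp [liftR], by
        simpa [liftR, show j + k + 1 + 1 - k = j + 2 by omega] using hj⟩
  · rintro (⟨h, h'⟩ | ⟨h, h'⟩)
    · interval_cases i
      exacts [⟨0, h', rfl⟩, ⟨1, h', rfl⟩]
    · obtain ⟨j, rfl⟩ := Nat.exists_eq_add_of_le h
      exact ⟨j + 2, by simpa [show k + 2 + j - k = j + 2 by omega] using h', by
        simp only [liftR]; omega⟩

lemma Term.Affine.shift {t : Term} (h : t.Affine) (k : ℕ) : (t.shift k).Affine :=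
  h.rename (add_left_injective k)

lemma Term.Affine.shiftUnder {t : Term} (h : t.Affine) (k : ℕ) : (t.shiftUnder k).Affine :=
  h.rename (liftR_injective (add_left_injective k))

lemma Term.Affine.shiftUnderTwo {t : Term} (h : t.Affine) (k : ℕ) : (t.shiftUnderTwo k).Affine :=
  h.rename (liftR_injective (liftR_injective (add_left_injective k)))

lemma Typed.var {i : ℕ} (h : Γ[i]? = some A) : Typed Γ (.var i) A :=
  ⟨trivial, fun j hj => by
    obtain rfl : j = i := hj
    exact (List.getElem?_eq_some_iff.1 h).1, fun _ hγ => isDist_dirac (hγ i A h)⟩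

lemma Typed.var_zero : Typed (A :: Γ) (.var 0) A := .var rfl

lemma Typed.star : Typed Γ .star (.unit : Ty C) :=
  ⟨trivial, fun _ h => h.elim, fun _ _ => isDist_dirac rfl⟩

lemma Typed.inl {t : Term} (h : Typed Γ t A) : Typed Γ (.inl t) (.sum A B) :=
  ⟨h.affine, h.fv_lt, fun γ hγ => (h.dist γ hγ).bind fun _ hv => isDist_dirac hv⟩

lemma Typed.inr {t : Term} (h : Typed Γ t B) : Typed Γ (.inr t) (.sum A B) :=
  ⟨h.affine, h.fv_lt, fun γ hγ => (h.dist γ hγ).bind fun _ hv => isDist_dirac hv⟩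

lemma Typed.top : Typed Γ .top (.two : Ty C) := Typed.star.inl

lemma Typed.fail : Typed Γ .fail A.partialTy := Typed.star.inr

lemma Typed.magic {t : Term} (h : Typed Γ t .empty) : Typed Γ (.magic t) A :=
  ⟨h.affine, h.fv_lt, fun γ hγ => (not_isDist_empty (h.dist γ hγ)).elim⟩

lemma Typed.pair {s t : Term} (hs : Typed Γ s A) (ht : Typed Δ t B) :
    Typed (Δ ++ Γ) (.pair (s.shift Δ.length) t) (.tensor A B) := by
  obtain ⟨hs1, hs2, hs3⟩ := hs
  obtain ⟨ht1, ht2, ht3⟩ := ht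
  refine ⟨⟨hs1.shift _, ht1, ?_⟩, ?_, fun γ hγ => ?_⟩
  · simp only [mem_fv_shift]; grind
  · simp only [Term.fv, Set.mem_union, mem_fv_shift, List.length_append]; grind
  · simp only [Term.sem, sem_shift]
    exact (hs3 _ hγ.right).bind fun v hv => (ht3 _ hγ.left).bind fun w hw => isDist_dirac ⟨hv, hw⟩

lemma IsDist.bind_onPair {f : Val → Val → Val →₀ ℝ} (hμ : IsDist (.tensor A B) μ)
    (hf : ∀ v w, A.Has v → B.Has w → IsDist D (f v w)) : IsDist D (COMET.bind μ (onPair f)) :=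
  hμ.bind fun u hu => match u, hu with
    | .pair v w, hu => hf v w hu.1 hu.2

lemma IsDist.bind_onSum {f g : Val → Val →₀ ℝ} (hμ : IsDist (.sum A B) μ)
    (hf : ∀ v, A.Has v → IsDist D (f v)) (hg : ∀ v, B.Has v → IsDist D (g v)) :
    IsDist D (COMET.bind μ (onSum f g)) :=
  hμ.bind fun u hu => match u, hu with
    | .inl v, hu => hf v hu
    | .inr v, hu => hg v hu

lemma Typed.letPair {s t : Term} (hs : Typed Γ s (.tensor A B)) (ht : Typed (B :: A :: Δ) t D) :
    Typed (Δ ++ Γ) (.letPair (s.shift Δ.length) t) D := by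
  obtain ⟨hs1, hs2, hs3⟩ := hs
  obtain ⟨ht1, ht2, ht3⟩ := ht
  simp only [List.length_cons] at ht2
  refine ⟨⟨hs1.shift _, ht1, ?_⟩, ?_, fun γ hγ => ?_⟩
  · simp only [mem_fv_shift]; grind
  · simp only [Term.fv, Set.mem_union, Set.mem_ofPred, mem_fv_shift, List.length_append]; grind
  · simp only [Term.sem, sem_shift]
    exact (hs3 _ hγ.right).bind_onPair fun v w hv hw => ht3 _ ((hγ.left.cons hv).cons hw)

lemma Typed.caseOf {r s t : Term} (hr : Typed Γ r (.sum A B)) (hs : Typed (A :: Δ) s D)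
    (ht : Typed (B :: Δ) t D) : Typed (Δ ++ Γ) (.caseOf (r.shift Δ.length) s t) D := by
  obtain ⟨hr1, hr2, hr3⟩ := hr
  obtain ⟨hs1, hs2, hs3⟩ := hs
  obtain ⟨ht1, ht2, ht3⟩ := ht
  simp only [List.length_cons] at hs2 ht2
  refine ⟨⟨hr1.shift _, hs1, ht1, ?_⟩, ?_, fun γ hγ => ?_⟩
  · simp only [mem_fv_shift]; grind
  · simp only [Term.fv, Set.mem_union, Set.mem_ofPred, mem_fv_shift, List.length_append]; grind
  · simp only [Term.sem, sem_shift]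
    exact (hr3 _ hγ.right).bind_onSum (fun v hv => hs3 _ (hγ.left.cons hv))
      fun v hv => ht3 _ (hγ.left.cons hv)

lemma Typed.caseOf_closed {r s t : Term} (hr : Typed Γ r (.sum A B)) (hs : Typed [A] s D)
    (ht : Typed [B] t D) : Typed Γ (.caseOf r s t) D := by
  simpa using Typed.caseOf (Δ := []) hr hs ht

lemma Typed.proj_zero {t : Term} (h : Typed Γ t (.sum A B)) :
    Typed Γ (.proj 2 0 t) A.partialTy :=
  h.caseOf_closed (s := .ret (.var 0)) (t := .fail) Typed.var_zero.inl Typed.fail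

lemma Typed.proj_one {t : Term} (h : Typed Γ t (.sum A B)) :
    Typed Γ (.proj 2 1 t) B.partialTy :=
  h.caseOf_closed (s := .fail) (t := .ret (.var 0)) Typed.fail Typed.var_zero.inl

lemma Typed.inst {t r : Term} (ht : Typed [A] t D) (hr : Typed Γ r A) :
    Typed Γ (t.inst r) D := by
  have ht0 (i : ℕ) (hi : i ∈ t.fv) : i = 0 := by simpa using ht.fv_lt i hi
  refine ⟨ht.affine.subst ⟨fun i hi => ?_, fun i hi j hj k _ _ => ?_⟩, fun i hi => ?_,
    fun γ hγ => ?_⟩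
  · obtain rfl := ht0 i hi
    exact hr.affine
  · rw [ht0 i hi, ht0 j hj]
  · obtain ⟨j, hj, hij⟩ := (mem_fv_subst ..).1 hi
    obtain rfl := ht0 j hj
    exact hr.fv_lt i hij
  · rw [sem_inst ht.affine (hr.dist γ hγ).mass_eq]
    exact (hr.dist γ hγ).bind fun v hv => ht.dist _ (EnvOf.singleton hv)

lemma Typed.shiftUnder_one {t : Term} (ht : Typed [A] t D) : Typed [A] (t.shiftUnder 1) D := by
  refine ⟨ht.affine.shiftUnder 1, fun i hi => ?_, fun γ hγ => ?_⟩
  · rcases mem_fv_shiftUnder.1 hi with h | h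
    · simp [h.1]
    · have := ht.fv_lt _ h.2
      simp at this; omega
  · rw [Term.shiftUnder, sem_rename]
    refine ht.dist _ ?_
    rintro (_ | i) B hB
    · exact hγ 0 B hB
    · simp at hB

lemma Typed.caseN {n : ℕ} {t : Term} {br : ℕ → Term} (ht : Typed Γ t (.copower n A))
    (hbr : ∀ i < n, Typed [A] (br i) D) : Typed Γ (.caseN n t br) D := by
  induction n generalizing Γ t br with
  | zero => exact Typed.magic ht
  | succ n ih =>
    rcases n with _ | n
    · exact (hbr 0 one_pos).inst ht
    · exact Typed.caseOf_closed ht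
        (ih Typed.var_zero fun i hi => (hbr i (by omega)).shiftUnder_one) (hbr _ (by omega))

lemma sem_caseN {n : ℕ} {t : Term} {br : ℕ → Term} (ht : IsDist (Ty.copower n A) (t.sem γ))
    (hbr : ∀ i < n, (br i).Affine) :
    (Term.caseN n t br).sem γ =
      bind (t.sem γ) fun u => (br (index n u)).sem (cons (strip n u) γ) := by
  induction n generalizing t br γ with
  | zero => exact (not_isDist_empty ht).elim
  | succ n ih =>
    rcases n with _ | n
    · exact sem_inst (hbr 0 one_pos) ht.mass_eq
    · refine ht.bind_congr fun u hu => ?_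
      rcases u with _ | _ | u | u
      · exact hu.elim
      · exact hu.elim
      · refine (ih (t := .var 0) (γ := cons u γ) (isDist_dirac hu)
          fun i hi => (hbr i (by omega)).shiftUnder 1).trans ?_
        simp [Term.sem, index, strip]
      · rfl

lemma Typed.inj {n i : ℕ} {t : Term} (ht : Typed Γ t A) (hi : i < n) :
    Typed Γ (.inj n i t) (.copower n A) := by
  induction n with
  | zero => omega
  | succ n ih =>
    rcases n with _ | n
    · exact ht
    rw [Term.inj]
    split_ifs with h
    · exact ht.inr
    · exact (ih (by omega)).inl

lemma Typed.nabla {n : ℕ} {t : Term} (ht : Typed Γ t (.copower n A)) : Typed Γ (.nabla n t) A :=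
  ht.caseN fun _ _ => Typed.var_zero

lemma Typed.ind {n : ℕ} {t : Term} (ht : Typed Γ t (.copower n A)) :
    Typed Γ (.ind n t) (.fin n) :=
  ht.caseN fun _ hi => Typed.star.inj hi

lemma sem_nabla {n : ℕ} {t : Term} (ht : IsDist (Ty.copower n A) (t.sem γ)) :
    (Term.nabla n t).sem γ = bind (t.sem γ) fun u => dirac (strip n u) :=
  sem_caseN ht fun _ _ => trivial

lemma sem_ind {n : ℕ} {t : Term} (ht : IsDist (Ty.copower n A) (t.sem γ)) :
    (Term.ind n t).sem γ = bind (t.sem γ) fun u => dirac (injV n (index n u) .star) := by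
  refine (sem_caseN ht fun i hi => ?_).trans ?_
  · exact (Typed.inj (C := C) (Γ := []) Typed.star hi).affine
  · simp [sem_inj, Term.sem]

lemma Typed.instr {n : ℕ} {s t : Term} (ht : Typed [A] t (.fin n)) (hs : Typed Γ s A) :
    Typed Γ (.instr t s) (.copower n A) := by
  refine ⟨⟨ht.affine, hs.affine, fun i hi => ?_⟩, ?_, fun γ hγ => ?_⟩
  · simpa using ht.fv_lt _ hi
  · rintro i (hi | hi)
    · simpa using ht.fv_lt _ hi
    · exact hs.fv_lt i hi
  · refine (hs.dist γ hγ).bind fun v hv => (ht.dist _ (EnvOf.singleton hv)).bind fun w hw => ?_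
    obtain ⟨i, hi, _, rfl, rfl⟩ := has_copower_iff.1 hw
    rw [tag_injV]
    exact isDist_dirac (has_copower_iff.2 ⟨i, hi, v, hv, rfl⟩)

lemma Typed.rename_swap {t : Term} (h : Typed (Δ ++ B :: A :: Γ) t D) :
    Typed (Δ ++ A :: B :: Γ) (t.rename (Equiv.swap Δ.length (Δ.length + 1))) D := by
  refine ⟨h.affine.rename (Equiv.injective _), fun i hi => ?_, fun γ hγ => ?_⟩
  · obtain ⟨j, hj, rfl⟩ := (mem_fv_rename ..).1 hi
    have := h.fv_lt j hj
    simp only [List.length_append, List.length_cons] at this ⊢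
    rw [Equiv.swap_apply_def]
    split_ifs <;> omega
  · rw [sem_rename]
    exact h.dist _ hγ.swap

lemma Typed.assertMap {p t : Term} (hp : Typed [A] p .two) (ht : Typed Γ t A) :
    Typed Γ (.assertMap p t) A.partialTy :=
  (Typed.instr (n := 2) hp ht).caseOf_closed Typed.var_zero.inl Typed.fail

/-! ### Validity of the rules for tensor products and coproducts -/

lemma Equal.beta_tensor {r s t : Term} (hr : Typed Γ r A) (hs : Typed Δ s B)
    (ht : Typed (B :: A :: Θ) t D) :
    Equal (Θ ++ (Δ ++ Γ))
      (.letPair (.pair ((r.shift Δ.length).shift Θ.length) (s.shift Θ.length)) t)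
      (t.instTwo ((r.shift Δ.length).shift Θ.length) (s.shift Θ.length)) D := by
  have ht2 := ht.fv_lt
  have hr2 := hr.fv_lt
  have hs2 := hs.fv_lt
  refine .of_left ((hr.pair hs).letPair ht) (ht.affine.subst ⟨?_, ?_⟩) (fun i hi => ?_)
    fun γ hγ => ?_
  · rintro (_ | _ | i) -
    exacts [hs.affine.shift _, (hr.affine.shift _).shift _, trivial]
  · simp only [List.length_cons] at ht2
    rintro (_ | _ | i) hi (_ | _ | j) hj k <;>
      simp only [mem_fv_shift, Term.fv, Set.mem_singleton_iff] <;> grind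
  · obtain ⟨j, hj, h⟩ := (mem_fv_subst ..).1 hi
    have hj := ht2 j hj
    simp only [List.length_cons, List.length_append] at hj ⊢
    rcases j with _ | _ | j <;> simp only [mem_fv_shift, Term.fv, Set.mem_singleton_iff] at h <;>
      grind
  · rw [sem_instTwo ht.affine]
    · simp [Term.sem, bind_bind, onPair]
    · simpa using (hr.dist _ hγ.right.right).mass_eq
    · simpa using (hs.dist _ hγ.right.left).mass_eq

lemma Equal.eta_tensor {t : Term} (ht : Typed Γ t (.tensor A B)) :
    Equal Γ (.letPair t (.pair (.var 1) (.var 0))) t (.tensor A B) := by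
  have h : Typed ([B] ++ [A]) (.pair (.var 1) (.var 0)) (.tensor A B) :=
    Typed.pair (s := .var 0) (t := .var 0) .var_zero .var_zero
  refine .of_left (by simpa using Typed.letPair (Δ := []) ht h) ht.affine ht.fv_lt fun γ hγ => ?_
  refine ((ht.dist γ hγ).bind_congr fun u hu => ?_).trans (bind_dirac_right _)
  match u, hu with
  | .pair v w, _ => simp [Term.sem, onPair]

lemma Equal.let_let {r s t : Term} (hr : Typed Γ r (.tensor A B))
    (hs : Typed (B :: A :: Δ) s (.tensor D E)) (ht : Typed (E :: D :: Θ) t F) :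
    Equal (Θ ++ (Δ ++ Γ))
      (.letPair (.letPair ((r.shift Δ.length).shift Θ.length) (s.shiftUnderTwo Θ.length)) t)
      (.letPair ((r.shift Δ.length).shift Θ.length)
        (.letPair (s.shiftUnderTwo Θ.length) (t.shiftUnderTwo 2))) F := by
  have hr2 := hr.fv_lt
  have hs2 := hs.fv_lt
  have ht2 := ht.fv_lt
  simp only [List.length_cons] at hs2 ht2
  refine .of_left ((hr.letPair hs).letPair ht) ⟨(hr.affine.shift _).shift _,
    ⟨hs.affine.shiftUnderTwo _, ht.affine.shiftUnderTwo _, ?_⟩, ?_⟩ ?_ fun γ hγ => ?_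
  · simp only [mem_fv_shiftUnderTwo]; grind
  · simp only [Term.fv, mem_fv_shiftUnderTwo, mem_fv_shift, Set.mem_union, Set.mem_ofPred]; grind
  · simp only [Term.fv, mem_fv_shiftUnderTwo, mem_fv_shift, Set.mem_union, Set.mem_ofPred,
      List.length_append]
    grind
  · simp only [Term.sem, bind_bind]
    congr 1
    funext u
    cases u <;> simp [onPair]

lemma Equal.let_pair {r s t : Term} (hr : Typed Γ r (.tensor A B))
    (hs : Typed (B :: A :: Δ) s D) (ht : Typed Θ t E) :
    Equal (Θ ++ (Δ ++ Γ))
      (.letPair ((r.shift Δ.length).shift Θ.length)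
        (.pair (s.shiftUnderTwo Θ.length) (t.shift 2)))
      (.pair (.letPair ((r.shift Δ.length).shift Θ.length) (s.shiftUnderTwo Θ.length)) t)
      (.tensor D E) := by
  have hr2 := hr.fv_lt
  have hs2 := hs.fv_lt
  have ht2 := ht.fv_lt
  simp only [List.length_cons] at hs2
  refine Equal.symm <| .of_left ((hr.letPair hs).pair ht) ⟨(hr.affine.shift _).shift _,
    ⟨hs.affine.shiftUnderTwo _, ht.affine.shift _, ?_⟩, ?_⟩ ?_ fun γ hγ => ?_
  · simp only [mem_fv_shiftUnderTwo, mem_fv_shift]; grind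
  · simp only [Term.fv, mem_fv_shiftUnderTwo, mem_fv_shift, Set.mem_union]; grind
  · simp only [Term.fv, mem_fv_shiftUnderTwo, mem_fv_shift, Set.mem_union, Set.mem_ofPred,
      List.length_append]
    grind
  · simp only [Term.sem, bind_bind]
    congr 1
    funext u
    cases u <;> simp [onPair]

lemma Typed.inst_shift {r s : Term} (hr : Typed Γ r A) (hs : Typed (A :: Δ) s D) :
    (s.inst (r.shift Δ.length)).Affine ∧
      ∀ i ∈ (s.inst (r.shift Δ.length)).fv, i < (Δ ++ Γ).length := by
  have hr2 := hr.fv_lt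
  have hs2 := hs.fv_lt
  simp only [List.length_cons] at hs2
  refine ⟨hs.affine.subst ⟨?_, ?_⟩, fun i hi => ?_⟩
  · rintro (_ | i) -
    exacts [hr.affine.shift _, trivial]
  · rintro (_ | i) hi (_ | j) hj k <;>
      simp only [mem_fv_shift, Term.fv, Set.mem_singleton_iff] <;> grind
  · obtain ⟨j, hj, h⟩ := (mem_fv_subst ..).1 hi
    simp only [List.length_append] at ⊢
    rcases j with _ | j <;> simp only [mem_fv_shift, Term.fv, Set.mem_singleton_iff] at h <;> grind

lemma Equal.beta_inl {r s t : Term} (hr : Typed Γ r A) (hs : Typed (A :: Δ) s D)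
    (ht : Typed (B :: Δ) t D) :
    Equal (Δ ++ Γ) (.caseOf (.inl (r.shift Δ.length)) s t) (s.inst (r.shift Δ.length)) D := by
  refine .of_left (hr.inl.caseOf hs ht) (hr.inst_shift hs).1 (hr.inst_shift hs).2 fun γ hγ => ?_
  rw [sem_inst hs.affine (by simpa using (hr.dist _ hγ.right).mass_eq)]
  simp [Term.sem, bind_bind, onSum]

lemma Equal.beta_inr {r s t : Term} (hr : Typed Γ r B) (hs : Typed (A :: Δ) s D)
    (ht : Typed (B :: Δ) t D) :
    Equal (Δ ++ Γ) (.caseOf (.inr (r.shift Δ.length)) s t) (t.inst (r.shift Δ.length)) D := by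
  refine .of_left (hr.inr.caseOf hs ht) (hr.inst_shift ht).1 (hr.inst_shift ht).2 fun γ hγ => ?_
  rw [sem_inst ht.affine (by simpa using (hr.dist _ hγ.right).mass_eq)]
  simp [Term.sem, bind_bind, onSum]

lemma Equal.eta_sum {t : Term} (ht : Typed Γ t (.sum A B)) :
    Equal Γ (.caseOf t (.inl (.var 0)) (.inr (.var 0))) t (.sum A B) := by
  refine .of_left (ht.caseOf_closed Typed.var_zero.inl Typed.var_zero.inr) ht.affine ht.fv_lt
    fun γ hγ => ?_
  refine ((ht.dist γ hγ).bind_congr fun u hu => ?_).trans (bind_dirac_right _)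
  match u, hu with
  | .inl v, _ => simp [Term.sem, onSum]
  | .inr v, _ => simp [Term.sem, onSum]

lemma Equal.case_case {r s s' t t' : Term} (hr : Typed Γ r (.sum A B))
    (hs : Typed (A :: Δ) s (.sum D E)) (hs' : Typed (B :: Δ) s' (.sum D E))
    (ht : Typed (D :: Θ) t F) (ht' : Typed (E :: Θ) t' F) :
    Equal (Θ ++ (Δ ++ Γ))
      (.caseOf (.caseOf ((r.shift Δ.length).shift Θ.length)
        (s.shiftUnder Θ.length) (s'.shiftUnder Θ.length)) t t')
      (.caseOf ((r.shift Δ.length).shift Θ.length)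
        (.caseOf (s.shiftUnder Θ.length) (t.shiftUnder 1) (t'.shiftUnder 1))
        (.caseOf (s'.shiftUnder Θ.length) (t.shiftUnder 1) (t'.shiftUnder 1))) F := by
  have hr2 := hr.fv_lt
  have hs2 := hs.fv_lt
  have hs2' := hs'.fv_lt
  have ht2 := ht.fv_lt
  have ht2' := ht'.fv_lt
  simp only [List.length_cons] at hs2 hs2' ht2 ht2'
  refine .of_left ((hr.caseOf hs hs').caseOf ht ht') ⟨(hr.affine.shift _).shift _,
    ⟨hs.affine.shiftUnder _, ht.affine.shiftUnder _, ht'.affine.shiftUnder _, ?_⟩,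
    ⟨hs'.affine.shiftUnder _, ht.affine.shiftUnder _, ht'.affine.shiftUnder _, ?_⟩, ?_⟩ ?_
    fun γ hγ => ?_
  · simp only [mem_fv_shiftUnder]; grind
  · simp only [mem_fv_shiftUnder]; grind
  · simp only [Term.fv, mem_fv_shiftUnder, mem_fv_shift, Set.mem_union, Set.mem_ofPred]; grind
  · simp only [Term.fv, mem_fv_shiftUnder, mem_fv_shift, Set.mem_union, Set.mem_ofPred,
      List.length_append]
    grind
  · simp only [Term.sem, bind_bind]
    congr 1
    funext u
    cases u <;> simp [onSum]

lemma Equal.case_pair {r s s' t : Term} (hr : Typed Γ r (.sum A B))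
    (hs : Typed (A :: Δ) s D) (hs' : Typed (B :: Δ) s' D) (ht : Typed Θ t E) :
    Equal (Θ ++ (Δ ++ Γ))
      (.caseOf ((r.shift Δ.length).shift Θ.length)
        (.pair (s.shiftUnder Θ.length) (t.shift 1)) (.pair (s'.shiftUnder Θ.length) (t.shift 1)))
      (.pair (.caseOf ((r.shift Δ.length).shift Θ.length)
        (s.shiftUnder Θ.length) (s'.shiftUnder Θ.length)) t) (.tensor D E) := by
  have hr2 := hr.fv_lt
  have hs2 := hs.fv_lt
  have hs2' := hs'.fv_lt
  have ht2 := ht.fv_lt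
  simp only [List.length_cons] at hs2 hs2'
  refine Equal.symm <| .of_left ((hr.caseOf hs hs').pair ht) ⟨(hr.affine.shift _).shift _,
    ⟨hs.affine.shiftUnder _, ht.affine.shift _, ?_⟩,
    ⟨hs'.affine.shiftUnder _, ht.affine.shift _, ?_⟩, ?_⟩ ?_ fun γ hγ => ?_
  · simp only [mem_fv_shiftUnder, mem_fv_shift]; grind
  · simp only [mem_fv_shiftUnder, mem_fv_shift]; grind
  · simp only [Term.fv, mem_fv_shiftUnder, mem_fv_shift, Set.mem_union]; grind
  · simp only [Term.fv, mem_fv_shiftUnder, mem_fv_shift, Set.mem_union, Set.mem_ofPred,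
      List.length_append]
    grind
  · simp only [Term.sem, bind_bind]
    congr 1
    funext u
    cases u <;> simp [onSum]

lemma Equal.let_case {r s s' t : Term} (hr : Typed Γ r (.sum A B))
    (hs : Typed (A :: Δ) s (.tensor D E)) (hs' : Typed (B :: Δ) s' (.tensor D E))
    (ht : Typed (E :: D :: Θ) t F) :
    Equal (Θ ++ (Δ ++ Γ))
      (.letPair (.caseOf ((r.shift Δ.length).shift Θ.length)
        (s.shiftUnder Θ.length) (s'.shiftUnder Θ.length)) t)
      (.caseOf ((r.shift Δ.length).shift Θ.length)
        (.letPair (s.shiftUnder Θ.length) (t.shiftUnderTwo 1))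
        (.letPair (s'.shiftUnder Θ.length) (t.shiftUnderTwo 1))) F := by
  have hr2 := hr.fv_lt
  have hs2 := hs.fv_lt
  have hs2' := hs'.fv_lt
  have ht2 := ht.fv_lt
  simp only [List.length_cons] at hs2 hs2' ht2
  refine .of_left ((hr.caseOf hs hs').letPair ht) ⟨(hr.affine.shift _).shift _,
    ⟨hs.affine.shiftUnder _, ht.affine.shiftUnderTwo _, ?_⟩,
    ⟨hs'.affine.shiftUnder _, ht.affine.shiftUnderTwo _, ?_⟩, ?_⟩ ?_ fun γ hγ => ?_
  · simp only [mem_fv_shiftUnder, mem_fv_shiftUnderTwo]; grind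
  · simp only [mem_fv_shiftUnder, mem_fv_shiftUnderTwo]; grind
  · simp only [Term.fv, mem_fv_shiftUnder, mem_fv_shiftUnderTwo, mem_fv_shift, Set.mem_union,
      Set.mem_ofPred]
    grind
  · simp only [Term.fv, mem_fv_shiftUnder, mem_fv_shiftUnderTwo, mem_fv_shift, Set.mem_union,
      Set.mem_ofPred, List.length_append]
    grind
  · simp only [Term.sem, bind_bind]
    congr 1
    funext u
    cases u <;> simp [onSum]

lemma Equal.pair {s s' t t' : Term} (hs : Equal Γ s s' A) (ht : Equal Δ t t' B) :
    Equal (Δ ++ Γ) (.pair (s.shift Δ.length) t) (.pair (s'.shift Δ.length) t') (.tensor A B) :=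
  ⟨hs.left.pair ht.left, hs.right.pair ht.right, fun γ hγ => by
    simp only [Term.sem, sem_shift, hs.sem_eq _ hγ.right, ht.sem_eq _ hγ.left]⟩

lemma Equal.letPair {s s' t t' : Term} (hs : Equal Γ s s' (.tensor A B))
    (ht : Equal (B :: A :: Δ) t t' D) :
    Equal (Δ ++ Γ) (.letPair (s.shift Δ.length) t) (.letPair (s'.shift Δ.length) t') D :=
  ⟨hs.left.letPair ht.left, hs.right.letPair ht.right, fun γ hγ => by
    simp only [Term.sem, sem_shift, hs.sem_eq _ hγ.right]
    refine (hs.right.dist _ hγ.right).bind_congr fun u hu => ?_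
    match u, hu with
    | .pair v w, hu => exact ht.sem_eq _ ((hγ.left.cons hu.1).cons hu.2)⟩

lemma Equal.caseOf {r r' s s' t t' : Term} (hr : Equal Γ r r' (.sum A B))
    (hs : Equal (A :: Δ) s s' D) (ht : Equal (B :: Δ) t t' D) :
    Equal (Δ ++ Γ) (.caseOf (r.shift Δ.length) s t) (.caseOf (r'.shift Δ.length) s' t') D :=
  ⟨hr.left.caseOf hs.left ht.left, hr.right.caseOf hs.right ht.right, fun γ hγ => by
    simp only [Term.sem, sem_shift, hr.sem_eq _ hγ.right]
    refine (hr.right.dist _ hγ.right).bind_congr fun u hu => ?_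
    match u, hu with
    | .inl v, hu => exact hs.sem_eq _ (hγ.left.cons hu)
    | .inr v, hu => exact ht.sem_eq _ (hγ.left.cons hu)⟩

/-! ### Validity of the rules for partial pairing, `left` and joint monicity -/

/-- The mass of the part of a measure that lives on right injections. -/
noncomputable def rightMass (μ : Val →₀ ℝ) : ℝ := bind μ (onSum (fun _ => 0) fun _ => 1)

lemma mass_leftPart (μ : Val →₀ ℝ) : mass (leftPart μ) = bind μ (onSum (fun _ => 1) fun _ => 0) :=
  bind_leftPart μ _

lemma IsDist.mass_add (hμ : IsDist (.sum A B) μ) : mass (leftPart μ) + rightMass μ = 1 := by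
  rw [mass_leftPart, rightMass, ← bind_add_right]
  refine (hμ.bind_congr fun u hu => ?_).trans hμ.mass_eq
  match u, hu with
  | .inl _, _ => exact add_zero 1
  | .inr _, _ => exact zero_add 1

lemma sem_dom_apply_top (t : Term) (γ : ℕ → Val) :
    t.dom.sem γ (.inl .star) = mass (leftPart (t.sem γ)) := by
  simp only [mass_leftPart, Term.dom, Term.isInl, Term.sem, Term.top, Term.bot, bind_apply]
  congr 1
  funext u; cases u <;> simp [onSum, dirac_apply_self]

lemma sem_isInl_apply_bot (t : Term) (γ : ℕ → Val) :
    t.isInl.sem γ (.inr .star) = rightMass (t.sem γ) := by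
  simp only [rightMass, Term.isInl, Term.sem, Term.top, Term.bot, bind_apply]
  congr 1
  funext u; cases u <;> simp [onSum, dirac_apply_self]

lemma sem_ker_apply_top (t : Term) (γ : ℕ → Val) :
    t.ker.sem γ (.inl .star) = rightMass (t.sem γ) := by
  simp only [rightMass, Term.ker, Term.sem, Term.top, Term.bot, bind_apply]
  congr 1
  funext u; cases u <;> simp [onSum, dirac_apply_self]

lemma proj_two_zero (t : Term) : Term.proj 2 0 t = .caseOf t (.ret (.var 0)) .fail := rfl

lemma proj_two_one (t : Term) : Term.proj 2 1 t = .caseOf t .fail (.ret (.var 0)) := rfl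

lemma sem_proj_zero_apply (t : Term) (γ : ℕ → Val) (v : Val) :
    (Term.proj 2 0 t).sem γ (.inl v) = t.sem γ (.inl v) := by
  rw [proj_two_zero, Term.sem, bind_apply]
  refine bind_eq_apply fun u => ?_
  cases u <;> simp [onSum, Term.fail, Term.ret, Term.sem, dirac_apply_of_ne]

lemma sem_proj_one_apply (t : Term) (γ : ℕ → Val) (v : Val) :
    (Term.proj 2 1 t).sem γ (.inl v) = t.sem γ (.inr v) := by
  rw [proj_two_one, Term.sem, bind_apply]
  refine bind_eq_apply fun u => ?_
  cases u <;> simp [onSum, Term.fail, Term.ret, Term.sem, dirac_apply_of_ne]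

lemma sem_inlr_apply_inl (s t : Term) (γ : ℕ → Val) (v : Val) :
    (Term.inlr s t).sem γ (.inl v) = s.sem γ (.inl v) := by
  simp only [Term.sem, Finsupp.add_apply, bind_apply]
  rw [bind_eq_apply (y := .inl v), bind_congr (g := fun _ => (0 : ℝ)), bind_zero_right, add_zero]
  · intro u _; cases u <;> simp [onSum]
  · intro u; cases u <;> simp [onSum, dirac_apply_of_ne]

lemma sem_inlr_apply_inr (s t : Term) (γ : ℕ → Val) (v : Val) :
    (Term.inlr s t).sem γ (.inr v) = t.sem γ (.inl v) := by
  simp only [Term.sem, Finsupp.add_apply, bind_apply]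
  rw [bind_congr (g := fun _ => (0 : ℝ)), bind_zero_right, zero_add, bind_eq_apply (y := .inl v)]
  · intro u; cases u <;> simp [onSum, dirac_apply_of_ne]
  · intro u _; cases u <;> simp [onSum]

lemma sem_inlr_apply_other {s t : Term} {γ : ℕ → Val} {u : Val} (hl : ∀ v, u ≠ .inl v)
    (hr : ∀ v, u ≠ .inr v) : (Term.inlr s t).sem γ u = 0 := by
  simp only [Term.sem, Finsupp.add_apply, bind_apply]
  rw [bind_congr (g := fun _ => (0 : ℝ)), bind_zero_right, zero_add,
    bind_congr (g := fun _ => (0 : ℝ)), bind_zero_right]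
  · intro w _; cases w <;> simp [onSum, dirac_apply_of_ne, (hr _).symm]
  · intro w _; cases w <;> simp [onSum, dirac_apply_of_ne, (hl _).symm]

lemma Typed.inlr {s t : Term} (hs : Typed Γ s A.partialTy) (ht : Typed Γ t B.partialTy)
    (h : Equal Γ s.dom t.ker .two) : Typed Γ (.inlr s t) (.sum A B) := by
  refine ⟨⟨hs.affine, ht.affine⟩, fun i hi => hi.elim (hs.fv_lt i) (ht.fv_lt i), fun γ hγ => ?_⟩
  refine ⟨fun u => ?_, fun u hu => ?_, ?_⟩
  · rcases u with _ | _ | v | v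
    · rw [sem_inlr_apply_other (by simp) (by simp)]
    · rw [sem_inlr_apply_other (by simp) (by simp)]
    · rw [sem_inlr_apply_inl]; exact (hs.dist γ hγ).nonneg _
    · rw [sem_inlr_apply_inr]; exact (ht.dist γ hγ).nonneg _
  · rcases u with _ | _ | v | v
    · exact (hu (sem_inlr_apply_other (by simp) (by simp))).elim
    · exact (hu (sem_inlr_apply_other (by simp) (by simp))).elim
    · rw [sem_inlr_apply_inl] at hu; exact (hs.dist γ hγ).has _ hu
    · rw [sem_inlr_apply_inr] at hu; exact (ht.dist γ hγ).has _ hu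
  · -- The mass of `s` on `A` is the mass of `t` outside `B`.
    have h' := congrArg (fun μ => μ (Val.inl .star)) (h.sem_eq γ hγ)
    simp only [sem_dom_apply_top, sem_ker_apply_top] at h'
    rw [← (ht.dist γ hγ).mass_add, ← h', add_comm, Term.sem, COMET.mass_add, mass_bind, mass_bind,
      mass_leftPart, mass_leftPart]
    congr 2 <;> funext u <;> cases u <;> simp [onSum, mass]

lemma Equal.beta_inlr_one {s t : Term} (hs : Typed Γ s A.partialTy) (ht : Typed Γ t B.partialTy)
    (h : Equal Γ s.dom t.ker .two) : Equal Γ (.proj 2 0 (.inlr s t)) s A.partialTy :=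
  ⟨(hs.inlr ht h).proj_zero, hs, fun γ hγ =>
    ((hs.inlr ht h).proj_zero.dist γ hγ).ext_partial (hs.dist γ hγ) fun v => by
      rw [sem_proj_zero_apply, sem_inlr_apply_inl]⟩

lemma Equal.beta_inlr_two {s t : Term} (hs : Typed Γ s A.partialTy) (ht : Typed Γ t B.partialTy)
    (h : Equal Γ s.dom t.ker .two) : Equal Γ (.proj 2 1 (.inlr s t)) t B.partialTy :=
  ⟨(hs.inlr ht h).proj_one, ht, fun γ hγ =>
    ((hs.inlr ht h).proj_one.dist γ hγ).ext_partial (ht.dist γ hγ) fun v => by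
      rw [sem_proj_one_apply, sem_inlr_apply_inr]⟩

lemma Equal.eta_inlr {t : Term} (ht : Typed Γ t (.sum A B)) :
    Equal Γ (.inlr (.proj 2 0 t) (.proj 2 1 t)) t (.sum A B) := by
  refine Equal.symm (.of_left ht ⟨ht.proj_zero.affine, ht.proj_one.affine⟩
    (fun i hi => hi.elim (ht.proj_zero.fv_lt i) (ht.proj_one.fv_lt i)) fun γ hγ => ?_)
  ext u
  rcases u with _ | _ | v | v
  · rw [sem_inlr_apply_other (by simp) (by simp)]
    exact by_contra fun h => (ht.dist γ hγ).has _ h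
  · rw [sem_inlr_apply_other (by simp) (by simp)]
    exact by_contra fun h => (ht.dist γ hγ).has _ h
  · rw [sem_inlr_apply_inl, sem_proj_zero_apply]
  · rw [sem_inlr_apply_inr, sem_proj_one_apply]

lemma Equal.inlr {s s' t t' : Term} (hs : Equal Γ s s' A.partialTy) (ht : Equal Γ t t' B.partialTy)
    (h : Equal Γ s.dom t.ker .two) : Equal Γ (.inlr s t) (.inlr s' t') (.sum A B) :=
  .of_left (hs.left.inlr ht.left h) ⟨hs.right.affine, ht.right.affine⟩
    (fun i hi => hi.elim (hs.right.fv_lt i) (ht.right.fv_lt i)) fun γ hγ => by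
      simp only [Term.sem, hs.sem_eq γ hγ, ht.sem_eq γ hγ]

/-- A distribution on `A + B` that satisfies `inl?` with certainty comes from `A`. -/
lemma IsDist.bind_leftPart_inl (hμ : IsDist (.sum A B) μ) (h : rightMass μ = 0) :
    COMET.bind (leftPart μ) (fun v => dirac (.inl v)) = μ := by
  have h0 := (bind_eq_zero_iff hμ.nonneg fun u => by cases u <;> simp [onSum]).1 h
  rw [bind_leftPart]
  refine (COMET.bind_congr fun u hu => ?_).trans (bind_dirac_right μ)
  match u, hμ.has u hu with
  | .inl v, _ => rfl
  | .inr v, _ => exact (one_ne_zero (h0 _ hu)).elim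

lemma rightMass_eq_zero {t : Term} (h : Equal Γ t.isInl .top .two) (hγ : EnvOf Γ γ) :
    rightMass (t.sem γ) = 0 := by
  rw [← sem_isInl_apply_bot, h.sem_eq γ hγ]
  simp [Term.top, Term.sem]

lemma Typed.left {t : Term} (ht : Typed Γ t (.sum A B)) (h : Equal Γ t.isInl .top .two) :
    Typed Γ (.left t) A := by
  refine ⟨ht.affine, ht.fv_lt, fun γ hγ => ⟨fun v => ?_, fun v hv => ?_, ?_⟩⟩
  · rw [Term.sem, leftPart_apply]; exact (ht.dist γ hγ).nonneg _
  · rw [Term.sem, leftPart_apply] at hv; exact (ht.dist γ hγ).has _ hv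
  · rw [Term.sem, ← (ht.dist γ hγ).mass_add, rightMass_eq_zero h hγ, add_zero]

lemma Equal.beta_left {t : Term} (ht : Typed Γ t (.sum A B)) (h : Equal Γ t.isInl .top .two) :
    Equal Γ (.inl (.left t)) t (.sum A B) :=
  ⟨(ht.left h).inl, ht, fun γ hγ => (ht.dist γ hγ).bind_leftPart_inl (rightMass_eq_zero h hγ)⟩

lemma Equal.eta_left {t : Term} (ht : Typed Γ t A) : Equal Γ (.left (.inl t)) t A := by
  refine Equal.symm (.of_left ht ht.affine ht.fv_lt fun γ hγ => ?_)
  simp [Term.sem, leftPart, bind_bind, onSum]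

lemma sem_doBind_proj_zero_apply (s : Term) (γ : ℕ → Val) (v : Val) :
    (Term.doBind s (.proj 2 0 (.var 0))).sem γ (.inl v) = s.sem γ (.inl (.inl v)) := by
  rw [Term.doBind, Term.sem, bind_apply]
  refine bind_eq_apply fun u => ?_
  cases u <;> simp [onSum, Term.fail, sem_proj_zero_apply, Term.sem, dirac_apply_of_ne]

lemma sem_doBind_proj_one_apply (s : Term) (γ : ℕ → Val) (v : Val) :
    (Term.doBind s (.proj 2 1 (.var 0))).sem γ (.inl v) = s.sem γ (.inl (.inr v)) := by
  rw [Term.doBind, Term.sem, bind_apply]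
  refine bind_eq_apply fun u => ?_
  cases u <;> simp [onSum, Term.fail, sem_proj_one_apply, Term.sem, dirac_apply_of_ne]

lemma Equal.joint_monic {s t : Term} (hs : Typed Γ s (A.sum B).partialTy)
    (ht : Typed Γ t (A.sum B).partialTy)
    (h0 : Equal Γ (.doBind s (.proj 2 0 (.var 0))) (.doBind t (.proj 2 0 (.var 0))) D)
    (h1 : Equal Γ (.doBind s (.proj 2 1 (.var 0))) (.doBind t (.proj 2 1 (.var 0))) E) :
    Equal Γ s t (A.sum B).partialTy := by
  refine ⟨hs, ht, fun γ hγ => (hs.dist γ hγ).ext_partial (ht.dist γ hγ) fun u => ?_⟩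
  by_cases hu : (A.sum B).Has u
  · match u, hu with
    | .inl v, _ => rw [← sem_doBind_proj_zero_apply, h0.sem_eq γ hγ, sem_doBind_proj_zero_apply]
    | .inr v, _ => rw [← sem_doBind_proj_one_apply, h1.sem_eq γ hγ, sem_doBind_proj_one_apply]
  · rw [show s.sem γ (.inl u) = 0 from by_contra fun h => hu ((hs.dist γ hγ).has _ h),
      show t.sem γ (.inl u) = 0 from by_contra fun h => hu ((ht.dist γ hγ).has _ h)]

/-! ### Validity of the rules for instruments -/

lemma bind_eq_apply_mul {X : Type*} {μ : X →₀ ℝ} {f : X → ℝ} {y : X} {c : ℝ}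
    (h : ∀ x, μ x ≠ 0 → f x = dirac x y * c) : bind μ f = μ y * c := by
  rw [bind_congr h, ← bind_eq_apply (fun x => rfl), mul_comm, ← smul_eq_mul, smul_bind]
  simp only [smul_eq_mul, mul_comm]

lemma Equal.instr {n : ℕ} {s s' t t' : Term} (ht : Equal [A] t t' (.fin n))
    (hs : Equal Γ s s' A) : Equal Γ (.instr t s) (.instr t' s') (.copower n A) :=
  ⟨ht.left.instr hs.left, ht.right.instr hs.right, fun γ hγ => by
    simp only [Term.sem, hs.sem_eq γ hγ]
    refine (hs.right.dist γ hγ).bind_congr fun v hv => ?_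
    rw [ht.sem_eq _ (EnvOf.singleton hv)]⟩

lemma Equal.nabla_instr {n : ℕ} {s t : Term} (ht : Typed [A] t (.fin n)) (hs : Typed Γ s A) :
    Equal Γ (.nabla n (.instr t s)) s A := by
  refine ⟨(ht.instr hs).nabla, hs, fun γ hγ => ?_⟩
  rw [sem_nabla ((ht.instr hs).dist γ hγ), Term.sem, bind_bind]
  refine ((hs.dist γ hγ).bind_congr fun v hv => ?_).trans (bind_dirac_right _)
  have hd := ht.dist _ (EnvOf.singleton (γ := γ) hv)
  rw [bind_bind, hd.bind_congr (g := fun _ => dirac v), bind_const, hd.mass_eq, one_smul]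
  intro w hw
  obtain ⟨i, hi, _, rfl, rfl⟩ := has_copower_iff.1 hw
  rw [bind_dirac_left, tag_injV, strip_injV hi]

lemma Equal.instr_test {n : ℕ} {s t : Term} (ht : Typed [A] t (.fin n)) (hs : Typed Γ s A) :
    Equal Γ (.ind n (.instr t s)) (t.inst s) (.fin n) := by
  refine ⟨(ht.instr hs).ind, ht.inst hs, fun γ hγ => ?_⟩
  rw [sem_ind ((ht.instr hs).dist γ hγ), Term.sem, bind_bind, sem_inst ht.affine
    (hs.dist γ hγ).mass_eq]
  refine (hs.dist γ hγ).bind_congr fun v hv => ?_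
  rw [bind_bind]
  refine ((ht.dist _ (EnvOf.singleton hv)).bind_congr fun w hw => ?_).trans (bind_dirac_right _)
  obtain ⟨i, hi, _, rfl, rfl⟩ := has_copower_iff.1 hw
  rw [bind_dirac_left, tag_injV, index_injV hi]

/-- A nonnegative measure with deterministic image under `f` lives on one fibre of `f`. -/
lemma eq_of_bind_dirac_eq {X Y : Type*} {μ : X →₀ ℝ} (hμ : ∀ x, 0 ≤ μ x) {f : X → Y} {y : Y}
    (h : bind μ (fun x => dirac (f x)) = dirac y) {x : X} (hx : μ x ≠ 0) : f x = y := by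
  classical
  by_contra hne
  have h0 : bind μ (fun x' => dirac (f x') (f x)) = 0 := by
    rw [← bind_apply, h, dirac_apply_of_ne (Ne.symm hne)]
  refine one_ne_zero ((dirac_apply_self (f x)).symm.trans
    ((bind_eq_zero_iff hμ fun x' => ?_).1 h0 x hx))
  simp only [dirac, Finsupp.single_apply]
  split_ifs <;> norm_num

/-- An instrument without side effects is determined by its test: as `∇ (r)` is deterministic,
every possible outcome of `r` at `v` is `v` itself, in some summand, and `ind` tells which. -/
lemma Equal.eta_instr {n : ℕ} {r s : Term} (hr : Typed [A] r (.copower n A))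
    (h : Equal [A] (.nabla n r) (.var 0) A) (hs : Typed Γ s A) :
    Equal Γ (.instr (.ind n r) s) (r.inst s) (.copower n A) := by
  refine ⟨hr.ind.instr hs, hr.inst hs, fun γ hγ => ?_⟩
  rw [Term.sem, sem_inst hr.affine (hs.dist γ hγ).mass_eq]
  refine (hs.dist γ hγ).bind_congr fun v hv => ?_
  have hd := hr.dist _ (EnvOf.singleton (γ := γ) hv)
  have hn := h.sem_eq _ (EnvOf.singleton (γ := γ) hv)
  rw [sem_nabla hd] at hn
  rw [sem_ind hd, bind_bind]
  refine (bind_congr fun u hu => ?_).trans (bind_dirac_right _)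
  have hu' : strip n u = v := eq_of_bind_dirac_eq hd.nonneg hn hu
  obtain ⟨i, hi, w, hw, rfl⟩ := has_copower_iff.1 (hd.has u hu)
  rw [strip_injV hi] at hu'
  rw [bind_dirac_left, tag_injV, index_injV hi, hu']

/-- Asserting `p` weights every value `v` with the probability of `p` at `v`. -/
lemma sem_assertMap_apply {p t : Term} (hp : Typed [A] p .two) (ht : Typed Γ t A)
    (hγ : EnvOf Γ γ) (v : Val) :
    (Term.assertMap p t).sem γ (.inl v) = t.sem γ v * p.sem (cons v γ) (.inl .star) := by
  rw [Term.assertMap, Term.sem, Term.sem, bind_apply, bind_bind]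
  refine bind_eq_apply_mul fun u hu => ?_
  rw [bind_bind, bind_eq_apply_mul (y := Val.inl .star) (c := dirac u v)]
  · by_cases h : u = v
    · rw [h, mul_comm]
    · rw [dirac_apply_of_ne h, mul_zero, zero_mul]
  · intro w hw
    have hw := (hp.dist _ (EnvOf.singleton ((ht.dist γ hγ).has u hu))).has w hw
    match w, hw with
    | .inl _, rfl => simp [onSum, tag, Term.ret, Term.sem, dirac_apply_self]
    | .inr _, rfl => simp [onSum, tag, Term.fail, Term.sem]

lemma sem_assertMap_assertMap_apply {p q t : Term} (hp : Typed [A] p .two) (hq : Typed [A] q .two)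
    (ht : Typed Γ t A) (hγ : EnvOf Γ γ) (v : Val) :
    (Term.doBind (.assertMap p t) (.assertMap q (.var 0))).sem γ (.inl v) =
      t.sem γ v * p.sem (cons v γ) (.inl .star) * q.sem (cons v γ) (.inl .star) := by
  rw [Term.doBind, Term.sem, bind_apply, ← sem_assertMap_apply hp ht hγ]
  refine bind_eq_apply_mul fun u hu => ?_
  match u, ((hp.assertMap ht).dist γ hγ).has u hu with
  | .inl u, (hu : A.Has u) =>
    have h0 : q.sem (cons v (cons u γ)) = q.sem (cons v γ) := sem_congr fun i hi => by
      obtain rfl : i = 0 := by simpa using hq.fv_lt i hi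
      rfl
    simp only [onSum]
    rw [sem_assertMap_apply (Γ := [A]) hq .var_zero (EnvOf.singleton hu), h0, dirac_inl_inl]
    rfl
  | .inr u, _ => simp [onSum, Term.fail, Term.sem]

lemma Equal.comm {p q t : Term} (hp : Typed [A] p .two) (hq : Typed [A] q .two)
    (ht : Typed Γ t A) :
    Equal Γ (.doBind (.assertMap p t) (.assertMap q (.var 0)))
      (.doBind (.assertMap q t) (.assertMap p (.var 0))) A.partialTy := by
  have h {p q : Term} (hp : Typed [A] p .two) (hq : Typed [A] q .two) :
      Typed Γ (.doBind (.assertMap p t) (.assertMap q (.var 0))) A.partialTy :=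
    (hp.assertMap ht).caseOf_closed (hq.assertMap .var_zero) Typed.fail
  refine ⟨h hp hq, h hq hp, fun γ hγ => ((h hp hq).dist γ hγ).ext_partial ((h hq hp).dist γ hγ)
    fun v => ?_⟩
  rw [sem_assertMap_assertMap_apply hp hq ht hγ, sem_assertMap_assertMap_apply hq hp ht hγ,
    mul_right_comm]

/-! ### Validity of the rules for scalars -/

lemma sem_nfold (m : ℕ) (t : Term) (γ : ℕ → Val) :
    (Term.nfold (m + 1) t).sem γ =
      (m + 1 : ℝ) • t.sem γ - (m * mass (t.sem γ)) • dirac (.inr .star) := by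
  induction m with
  | zero => simp [Term.nfold]
  | succ m ih =>
    rw [Term.nfold, Term.sem, ih]
    simp only [mass_sub, mass_smul, mass_dirac]
    push_cast
    module

lemma affine_nfold {m : ℕ} {t : Term} : (Term.nfold (m + 1) t).Affine ↔ t.Affine := by
  induction m with
  | zero => rfl
  | succ m ih => rw [Term.nfold, Term.Affine, ih, and_self]

lemma fv_nfold {m : ℕ} {t : Term} : (Term.nfold (m + 1) t).fv = t.fv := by
  induction m with
  | zero => rfl
  | succ m ih => rw [Term.nfold, Term.fv, ih, Set.union_self]

lemma sem_nfold_recip (m n : ℕ) (γ : ℕ → Val) :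
    (Term.nfold (m + 1) (.recip n)).sem γ =
      ((m + 1 : ℝ) / n) • dirac (.inl .star) + (1 - (m + 1 : ℝ) / n) • dirac (.inr .star) := by
  rw [sem_nfold]
  simp only [Term.sem, mass_add, mass_smul, mass_dirac]
  rw [div_eq_mul_one_div ((m : ℝ) + 1)]
  module

lemma Typed.nfold_recip {m n : ℕ} (hm : m + 1 ≤ n) :
    Typed Γ (.nfold (m + 1) (.recip n)) (.two : Ty C) := by
  refine ⟨affine_nfold.2 trivial, fun i hi => ?_, fun γ _ => ?_⟩
  · rw [fv_nfold] at hi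
    exact hi.elim
  · have h : ((m + 1 : ℕ) : ℝ) / n ≤ 1 := div_le_one_of_le₀ (by exact_mod_cast hm) n.cast_nonneg
    push_cast at h
    rw [sem_nfold_recip]
    exact IsDist.add_smul (by positivity) (by linarith) (by ring) (isDist_dirac rfl)
      (isDist_dirac rfl)

lemma Typed.recip {n : ℕ} (hn : 2 ≤ n) : Typed Γ (.recip n) (.two : Ty C) :=
  Typed.nfold_recip (m := 0) (by omega)

lemma Equal.nfold_recip {n : ℕ} (hn : 2 ≤ n) :
    Equal Γ (.nfold n (.recip n)) .top (.two : Ty C) := by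
  obtain ⟨m, rfl⟩ := Nat.exists_eq_add_of_le' (show 1 ≤ n by omega)
  refine ⟨.nfold_recip le_rfl, .top, fun γ _ => ?_⟩
  have : (m + 1 : ℝ) / (m + 1 : ℕ) = 1 := by push_cast; exact div_self (by positivity)
  rw [sem_nfold_recip, this]
  simp [Term.top, Term.sem]

/-- Comparing total masses shows that a solution of `n · t = ⊤` has mass `1`; the rest is linear
algebra. -/
lemma Equal.divide {n : ℕ} {t : Term} (hn : 2 ≤ n) (h : Equal Γ (.nfold n t) .top .two) :
    Equal Γ t (.recip n) (.two : Ty C) := by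
  obtain ⟨m, rfl⟩ := Nat.exists_eq_add_of_le' (show 1 ≤ n by omega)
  refine Equal.symm (.of_left (.recip hn) (affine_nfold.1 h.left.affine)
    (fun i hi => h.left.fv_lt i (by rwa [fv_nfold])) fun γ hγ => ?_)
  have h' := h.sem_eq γ hγ
  have hm := congrArg mass h'
  have htop : Term.top.sem γ = dirac (.inl .star) := by simp [Term.top, Term.sem]
  rw [sem_nfold, htop] at h' hm
  simp only [mass_sub, mass_smul, mass_dirac] at hm
  have hm : mass (t.sem γ) = 1 := by linarith
  rw [hm, sub_eq_iff_eq_add] at h'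
  have hpos : (m + 1 : ℝ) ≠ 0 := by positivity
  rw [← inv_smul_smul₀ hpos (t.sem γ), h', Term.sem, smul_add, smul_smul]
  push_cast
  congr 2
  · rw [one_div]
  · field_simp
    ring

lemma Typed.bound {m n : ℕ} (hmn : m < n) : Typed Γ (.bound m n) (.fin 3 : Ty C) := by
  refine ⟨trivial, fun i hi => hi.elim, fun γ _ => ?_⟩
  have hn : (0 : ℝ) < n := by exact_mod_cast (Nat.zero_le m).trans_lt hmn
  have h : (m + 1 : ℝ) / n ≤ 1 := (div_le_one hn).2 (by exact_mod_cast hmn)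
  have h0 : (0 : ℝ) < (m + 1) / n := by positivity
  -- The first two outcomes, taken together and normalised, form a distribution of their own.
  have h1 := IsDist.add_smul (A := (.fin 3 : Ty C)) (a := m / (m + 1)) (b := 1 / (m + 1))
    (μ := dirac (.inl (.inl .star))) (ν := dirac (.inl (.inr .star))) (by positivity)
    (by positivity) (by field_simp) (isDist_dirac rfl) (isDist_dirac rfl)
  have h2 := IsDist.add_smul h0.le (sub_nonneg.2 h) (by ring) h1
    (isDist_dirac (v := .inr .star) rfl)
  rw [smul_add, smul_smul, smul_smul] at h2
  convert h2 using 1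
  rw [Term.sem]
  congr 3 <;> field_simp

lemma Equal.proj_one_bound {m n : ℕ} (hm : 1 ≤ m) (hmn : m < n) :
    Equal Γ (.proj 3 0 (.bound m n)) (.nfold m (.recip n)) (.two : Ty C) := by
  obtain ⟨k, rfl⟩ := Nat.exists_eq_add_of_le' hm
  have hl : Typed Γ (.proj 3 0 (.bound (k + 1) n)) (.two : Ty C) :=
    (Typed.bound hmn).caseOf_closed
      (Typed.var_zero.caseOf_closed (s := .ret (.var 0)) (t := .fail) Typed.var_zero.inl .fail)
      Typed.fail
  have hr : Typed Γ (.nfold (k + 1) (.recip n)) (.two : Ty C) := Typed.nfold_recip hmn.le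
  refine ⟨hl, hr, fun γ hγ => (hl.dist γ hγ).ext_partial (hr.dist γ hγ) fun v => ?_⟩
  rw [show Term.proj 3 0 (.bound (k + 1) n) = .caseOf (.bound (k + 1) n)
    (.caseOf (.var 0) (.ret (.var 0)) .fail) .fail from rfl, sem_nfold_recip]
  simp [Term.sem, onSum, Term.ret, Term.fail]

lemma Equal.proj_two_bound {m n : ℕ} (hm : 1 ≤ m) (hmn : m < n) :
    Equal Γ (.proj 3 1 (.bound m n)) (.recip n) (.two : Ty C) := by
  have hl : Typed Γ (.proj 3 1 (.bound m n)) (.two : Ty C) :=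
    (Typed.bound hmn).caseOf_closed
      (Typed.var_zero.caseOf_closed (s := .fail) (t := .ret (.var 0)) .fail Typed.var_zero.inl)
      Typed.fail
  have hr : Typed Γ (.recip n) (.two : Ty C) := Typed.recip (by omega)
  refine ⟨hl, hr, fun γ hγ => (hl.dist γ hγ).ext_partial (hr.dist γ hγ) fun v => ?_⟩
  rw [show Term.proj 3 1 (.bound m n) = .caseOf (.bound m n)
    (.caseOf (.var 0) .fail (.ret (.var 0))) .fail from rfl]
  simp [Term.sem, onSum, Term.ret, Term.fail]

/-! ### Validity of the rules for normalisation -/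

lemma Typed.closed_shift {t : Term} (ht : Typed [] t A) (k : ℕ) : Typed Γ (t.shift k) A := by
  refine ⟨ht.affine.shift k, fun i hi => ?_, fun γ _ => ?_⟩
  · exact absurd (ht.fv_lt _ (mem_fv_shift.1 hi).2) (Nat.not_lt_zero _)
  · rw [sem_shift]
    exact ht.dist _ (envOf_nil _)

lemma Typed.closed {t : Term} (ht : Typed [] t A) : Typed Γ t A := by
  simpa using ht.closed_shift (Γ := Γ) 0

lemma mass_leftPart_pos {n : ℕ} {t : Term} (hn : 2 ≤ n)
    (h : Valid ([] : Ctx C) (.le (.recip n) t.dom .two)) (γ : ℕ → Val) :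
    0 < mass (leftPart (t.sem γ)) := by
  have h' := h γ (envOf_nil γ) .star
  rw [sem_dom_apply_top] at h'
  refine lt_of_lt_of_le ?_ h'
  simp [Term.sem, dirac_apply_self]
  omega

lemma Typed.norm {n : ℕ} {t : Term} (ht : Typed [] t A.partialTy) (hn : 2 ≤ n)
    (h : Valid ([] : Ctx C) (.le (.recip n) t.dom .two)) : Typed Γ (.norm t) A := by
  refine ⟨⟨ht.affine, fun i hi => absurd (ht.fv_lt i hi) (Nat.not_lt_zero _)⟩,
    (ht.closed (Γ := Γ)).fv_lt, fun γ _ => ?_⟩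
  have hpos := mass_leftPart_pos hn h γ
  have hd := ht.dist γ (envOf_nil γ)
  refine ⟨fun v => ?_, fun v hv => ?_, ?_⟩
  · rw [Term.sem, Finsupp.smul_apply, leftPart_apply]
    exact mul_nonneg (inv_nonneg.2 hpos.le) (hd.nonneg _)
  · rw [Term.sem, Finsupp.smul_apply, leftPart_apply] at hv
    exact hd.has _ (right_ne_zero_of_mul hv)
  · rw [Term.sem, mass_smul, inv_mul_cancel₀ hpos.ne']

lemma sem_doBind_ret_shift_apply (t ρ : Term) (γ : ℕ → Val) (v : Val) :
    (Term.doBind t (.ret (ρ.shift 1))).sem γ (.inl v) =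
      ρ.sem γ v * mass (leftPart (t.sem γ)) := by
  rw [Term.doBind, Term.sem, bind_apply, mass_leftPart, ← smul_eq_mul, smul_bind]
  congr 1
  funext u
  rcases u with _ | _ | u | u
  · simp [onSum]
  · simp [onSum]
  · simp only [onSum, Term.ret, Term.sem, sem_shift, cons_succ, smul_eq_mul, mul_one, bind_apply]
    exact bind_eq_apply fun x => dirac_inl_inl x v
  · simp [onSum, Term.fail, Term.sem]

lemma Equal.beta_norm {n : ℕ} {t : Term} (ht : Typed [] t A.partialTy) (hn : 2 ≤ n)
    (h : Valid ([] : Ctx C) (.le (.recip n) t.dom .two)) :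
    Equal Γ (.doBind t (.ret ((Term.norm t).shift 1))) t A.partialTy := by
  have hl : Typed Γ (.doBind t (.ret ((Term.norm t).shift 1))) A.partialTy :=
    ht.closed.caseOf_closed ((ht.norm hn h).closed_shift 1).inl Typed.fail
  refine ⟨hl, ht.closed, fun γ hγ =>
    (hl.dist γ hγ).ext_partial (ht.dist γ (envOf_nil γ)) fun v => ?_⟩
  rw [sem_doBind_ret_shift_apply, Term.sem, Finsupp.smul_apply, leftPart_apply, smul_eq_mul,
    mul_right_comm, inv_mul_cancel₀ (mass_leftPart_pos hn h γ).ne', one_mul]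

lemma Equal.eta_norm {n : ℕ} {t ρ : Term} (ht : Typed [] t A.partialTy) (hn : 2 ≤ n)
    (h : Valid ([] : Ctx C) (.le (.recip n) t.dom .two)) (hρ : Typed Γ ρ A)
    (he : Equal Γ t (.doBind t (.ret (ρ.shift 1))) A.partialTy) : Equal Γ ρ (.norm t) A := by
  refine ⟨hρ, ht.norm hn h, fun γ hγ => ?_⟩
  ext v
  rw [Term.sem, Finsupp.smul_apply, leftPart_apply]
  conv_rhs => rw [he.sem_eq γ hγ]
  rw [sem_doBind_ret_shift_apply, ← he.sem_eq γ hγ, smul_eq_mul, mul_comm, mul_assoc,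
    mul_inv_cancel₀ (mass_leftPart_pos hn h γ).ne', mul_one]

/-! ### Validity of the rules for partial sums -/

lemma Typed.doBind_nabla {b : Term} (hb : Typed Γ b (A.sum A).partialTy) :
    Typed Γ (.doBind b (.ret (.nabla 2 (.var 0)))) A.partialTy :=
  hb.caseOf_closed (Typed.nabla (n := 2) .var_zero).inl Typed.fail

lemma nabla_two (t : Term) : Term.nabla 2 t = .caseOf t (.var 0) (.var 0) := rfl

lemma Equal.ovee {b s t : Term} (hb : Typed Γ b (A.sum A).partialTy)
    (hs : Equal Γ (.doBind b (.proj 2 0 (.var 0))) s A.partialTy)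
    (ht : Equal Γ (.doBind b (.proj 2 1 (.var 0))) t A.partialTy) :
    Equal Γ (.ovee s t) (.doBind b (.ret (.nabla 2 (.var 0)))) A.partialTy := by
  refine Equal.symm (.of_left hb.doBind_nabla ⟨hs.right.affine, ht.right.affine⟩
    (fun i hi => hi.elim (hs.right.fv_lt i) (ht.right.fv_lt i)) fun γ hγ => ?_)
  have hd := hb.dist γ hγ
  rw [Term.sem, (hs.right.dist γ hγ).mass_eq, ← hd.mass_eq, ← bind_const, eq_sub_iff_add_eq,
    ← hs.sem_eq γ hγ, ← ht.sem_eq γ hγ, proj_two_zero, proj_two_one, nabla_two]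
  simp only [Term.doBind, Term.sem, ← bind_add_right]
  refine hd.bind_congr fun u hu => ?_
  match u, hu with
  | .inl (.inl v), _ => simp [onSum, Term.fail, Term.ret, Term.sem]
  | .inl (.inr v), _ => simp [onSum, Term.fail, Term.ret, Term.sem, add_comm]
  | .inr _, rfl => simp [onSum, Term.fail, Term.sem]

lemma sem_doBind_nabla_apply (b : Term) (γ : ℕ → Val) (v : Val) :
    (Term.doBind b (.ret (.nabla 2 (.var 0)))).sem γ (.inl v) =
      b.sem γ (.inl (.inl v)) + b.sem γ (.inl (.inr v)) := by
  have h (y : Val) : b.sem γ y = bind (b.sem γ) fun u => dirac u y :=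
    (bind_eq_apply fun _ => rfl).symm
  rw [Term.doBind, Term.sem, bind_apply, h (.inl (.inl v)), h (.inl (.inr v)), ← bind_add_right,
    nabla_two]
  congr 1
  funext u
  rcases u with _ | _ | (_ | _ | u | u) | u <;>
    simp [onSum, Term.fail, Term.ret, Term.sem, dirac_apply_of_ne]

/-! ### Soundness -/

/-- Every derivable judgement is valid in the model. -/
theorem Derivable.valid {J : Stmt C} (h : Derivable Γ J) : Valid Γ J := by
  induction h with
  | @exch Γ Δ A B J _ ih =>
    cases J with
    | hasType => exact Typed.rename_swap ih
    | eq =>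
      exact ⟨ih.left.rename_swap, ih.right.rename_swap, fun γ hγ => by
        simp only [sem_rename, ih.sem_eq _ hγ.swap]⟩
    | le => exact fun γ hγ v => by simpa only [sem_rename] using ih _ hγ.swap v
  | var h => exact .var h
  | refl _ h => exact ⟨h, h, fun _ _ => rfl⟩
  | symm _ h => exact Equal.symm h
  | trans _ _ h h' =>
    exact ⟨h.left, h'.right, fun γ hγ => (h.sem_eq γ hγ).trans (h'.sem_eq γ hγ)⟩
  | unit => exact .star
  | eta_one _ h => exact ⟨h, .star, fun γ hγ => (h.dist γ hγ).eq_dirac⟩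
  | pair _ _ hs ht => exact Typed.pair hs ht
  | letPair _ _ hs ht => exact Typed.letPair hs ht
  | pair_eq _ _ hs ht => exact Equal.pair hs ht
  | letPair_eq _ _ hs ht => exact Equal.letPair hs ht
  | beta_tensor _ _ _ hr hs ht => exact .beta_tensor hr hs ht
  | eta_tensor _ ht => exact .eta_tensor ht
  | let_let _ _ _ hr hs ht => exact .let_let hr hs ht
  | let_pair _ _ _ hr hs ht => exact .let_pair hr hs ht
  | magic _ h => exact Typed.magic h
  | eta_zero _ _ hs ht =>
    exact ⟨Typed.magic hs, ht, fun γ hγ => (not_isDist_empty (hs.dist γ hγ)).elim⟩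
  | inl _ h => exact Typed.inl h
  | inr _ h => exact Typed.inr h
  | inl_eq _ h =>
    exact ⟨h.left.inl, h.right.inl, fun γ hγ => by simp only [Term.sem, h.sem_eq γ hγ]⟩
  | inr_eq _ h =>
    exact ⟨h.left.inr, h.right.inr, fun γ hγ => by simp only [Term.sem, h.sem_eq γ hγ]⟩
  | caseOf _ _ _ hr hs ht => exact Typed.caseOf hr hs ht
  | caseOf_eq _ _ _ hr hs ht => exact Equal.caseOf hr hs ht
  | beta_inl _ _ _ hr hs ht => exact .beta_inl hr hs ht
  | beta_inr _ _ _ hr hs ht => exact .beta_inr hr hs ht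
  | eta_sum _ ht => exact .eta_sum ht
  | case_case _ _ _ _ _ hr hs hs' ht ht' => exact .case_case hr hs hs' ht ht'
  | case_pair _ _ _ _ hr hs hs' ht => exact .case_pair hr hs hs' ht
  | let_case _ _ _ _ hr hs hs' ht => exact .let_case hr hs hs' ht
  | inlr _ _ _ hs ht h => exact Typed.inlr hs ht h
  | inlr_eq _ _ _ hs ht h => exact Equal.inlr hs ht h
  | beta_inlr_one _ _ _ hs ht h => exact .beta_inlr_one hs ht h
  | beta_inlr_two _ _ _ hs ht h => exact .beta_inlr_two hs ht h
  | eta_inlr _ ht => exact .eta_inlr ht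
  | left _ _ ht h => exact Typed.left ht h
  | left_eq _ _ ht h =>
    exact .of_left (ht.left.left h) ht.right.affine ht.right.fv_lt fun γ hγ => by
      simp only [Term.sem, ht.sem_eq γ hγ]
  | beta_left _ _ ht h => exact .beta_left ht h
  | eta_left _ ht => exact .eta_left ht
  | joint_monic _ _ _ _ hs ht h0 h1 => exact .joint_monic hs ht h0 h1
  | instr _ _ ht hs => exact Typed.instr ht hs
  | nabla_instr _ _ ht hs => exact .nabla_instr ht hs
  | instr_test _ _ ht hs => exact .instr_test ht hs
  | eta_instr _ _ _ hr h hs => exact .eta_instr hr h hs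
  | instr_eq _ _ ht hs => exact Equal.instr ht hs
  | comm _ _ _ hp hq ht => exact .comm hp hq ht
  | recip hn => exact .recip hn
  | nfold_recip hn => exact .nfold_recip hn
  | divide hn _ h => exact .divide hn h
  | bound _ hmn => exact .bound hmn
  | proj_one_bound hm hmn => exact .proj_one_bound hm hmn
  | proj_two_bound hm hmn => exact .proj_two_bound hm hmn
  | norm _ hn _ ht h => exact Typed.norm ht hn h
  | beta_norm _ hn _ ht h => exact .beta_norm ht hn h
  | eta_norm _ hn _ _ _ ht h hρ he => exact .eta_norm ht hn h hρ he
  | ovee _ _ _ hb hs ht => exact (Equal.ovee hb hs ht).left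
  | ovee_def _ _ _ hb hs ht => exact Equal.ovee hb hs ht
  | le_intro _ _ _ hb hs ht =>
    intro γ hγ v
    rw [← hs.sem_eq γ hγ, ← ht.sem_eq γ hγ, sem_doBind_proj_zero_apply, sem_doBind_nabla_apply]
    exact le_add_of_nonneg_right ((hb.dist γ hγ).nonneg _)

end COMET

theorem mainTheorem2 (C : Type*) :
    (∃ (Γ : COMET.Ctx C) (J : COMET.Stmt C), ¬ COMET.Derivable Γ J) ∧
      ¬ COMET.Derivable ([] : COMET.Ctx C)
        (COMET.Stmt.eq COMET.Term.top COMET.Term.bot COMET.Ty.two) := by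
  suffices h : ¬ COMET.Derivable ([] : COMET.Ctx C)
      (COMET.Stmt.eq COMET.Term.top COMET.Term.bot COMET.Ty.two) from ⟨⟨_, _, h⟩, h⟩
  intro h
  -- The value `inl *` has probability `1` under `⊤` and `0` under `⊥`.
  have h' := congrArg (fun μ => μ (COMET.Val.inl .star))
    (h.valid.sem_eq (fun _ => .star) (COMET.envOf_nil _))
  simp [COMET.Term.top, COMET.Term.bot, COMET.Term.sem, COMET.dirac_apply_self] at h'
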